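/- **Theorem.** Given a string $S$ of length $n$ over a finite totally ordered alphabet, its Lyndon array $\lambda$ can be computed in $O(n)$ time using $O(1)$ words of working space apart from the space needed for $S$ and $\lambda$. Here a *Lyndon word* is a non-empty string that is lexicographically smaller than each of its proper non-empty suffixes, and $\lambda[i]$ is the maximum of all $\ell$ such that the substring of length $\ell$ of $S$ that starts at position $i$ exists and is a Lyndon word. The model of computation is the word RAM with words of $w$ bits, where $w$ is arbitrary subject to $n<2^w$ (so that the numbers $0,\dots,n$ fit in a word). Precisely: there are a number $k$, a constant $c$ and a single finite program, all independent of the alphabet, of $S$ and of $w$, such that for every finite totally ordered alphabet, every string $S$ over it, with length $n$, and every $w$ with $n<2^w$, the following holds. The memory consists of the input $S$, which is read-only and whose symbols can only be compared with each other, of an output array of exactly $n$ words, and of $k$ further words (registers). Each elementary instruction (loading a constant or $n$, copying a register, addition, subtraction, multiplication, bitwise operations, shifts, reading or writing an array entry) and each elementary test (comparison of two registers, or of two symbols of $S$) takes one step, and programs are built from these by sequencing, if-then-else and while loops. Started with arbitrary contents of the registers and of the output array, the program halts after at most $c\,(n+1)$ steps without any out-of-bounds access, and then the output array is $\lambda$.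 -/

import Mathlib

/-! ### Lyndon words and the Lyndon array -/

/-- A Lyndon word: a non-empty string that is lexicographically smaller than each of its proper
non-empty suffixes (`<` on lists is the lexicographic order, a proper prefix being smaller). -/
def IsLyndonWord {α : Type*} [LinearOrder α] (u : List α) : Prop :=
  u ≠ [] ∧ ∀ i : ℕ, 0 < i → i < u.length → u < u.drop i

/-- `lam` is the Lyndon array of `S`: the entry `lam i` is the maximum of all `l` such that the
substring of length `l` of `S` that starts at position `i` is a Lyndon word. Positions are counted
from `0`; the condition `i + l ≤ S.length` says that the substring does not exceed `S`. -/
def IsLyndonArray {α : Type*} [LinearOrder α] (S : List α) (lam : Fin S.length → ℕ) : Prop :=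
  ∀ i : Fin S.length,
    IsGreatest {l : ℕ | (i : ℕ) + l ≤ S.length ∧ IsLyndonWord ((S.drop i).take l)} (lam i)

namespace WordRAM

/-! ### The word RAM

The machine works on words of `w` bits. Its memory consists of
* the input string `S`, which is read-only, and whose symbols can only be compared,
* the output array, which has one word for each position of `S`,
* `k` further words, called registers.

A program is a fixed finite text. There is no stack, no recursion, and no other memory. -/

/-- The arithmetic, bitwise and shift operations on words. -/
inductive BinOp : Type
  | add | sub | mul | and | or | xor | shl | shr

/-- The value of an operation on `w`-bit words (unsigned, modulo `2 ^ w`). -/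
def BinOp.eval {w : ℕ} : BinOp → BitVec w → BitVec w → BitVec w
  | .add, x, y => x + y
  | .sub, x, y => x - y
  | .mul, x, y => x * y
  | .and, x, y => x &&& y
  | .or, x, y => x ||| y
  | .xor, x, y => x ^^^ y
  | .shl, x, y => x <<< y.toNat
  | .shr, x, y => x >>> y.toNat

/-- The elementary instructions of a program that uses `k` registers. -/
inductive Instr (k : ℕ) : Type
  /-- no operation -/
  | nop
  /-- `d := c`, for a constant `c` of the program -/
  | const (d : Fin k) (c : ℕ)
  /-- `d := n`, the length of the input string -/
  | len (d : Fin k)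
  /-- `d := a` -/
  | mov (d a : Fin k)
  /-- `d := a op b` -/
  | bin (op : BinOp) (d a b : Fin k)
  /-- `d := A[a]`, where `A` is the output array -/
  | load (d a : Fin k)
  /-- `A[a] := b`, where `A` is the output array -/
  | store (a b : Fin k)

/-- The elementary tests of a program that uses `k` registers. -/
inductive Test (k : ℕ) : Type
  /-- `a = b` for the words in two registers -/
  | eq (a b : Fin k)
  /-- `a < b` for the words in two registers, as unsigned numbers -/
  | lt (a b : Fin k)
  /-- `S[a] = S[b]` for two symbols of the input string -/
  | symEq (a b : Fin k)
  /-- `S[a] < S[b]` for two symbols of the input string -/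
  | symLt (a b : Fin k)

/-- Programs that use `k` registers. -/
inductive Prog (k : ℕ) : Type
  | instr (i : Instr k)
  | seq (p q : Prog k)
  | ite (b : Test k) (p q : Prog k)
  | while (b : Test k) (p : Prog k)

/-- The contents of the writable memory: `k` registers and an array of `n` words. -/
structure State (k w n : ℕ) : Type where
  reg : Fin k → BitVec w
  arr : Fin n → BitVec w

/-- The effect of an elementary instruction; `none` if the array is accessed out of bounds. -/
def Instr.run {k w n : ℕ} : Instr k → State k w n → Option (State k w n)
  | .nop, s => some s
  | .const d c, s => some { s with reg := Function.update s.reg d (BitVec.ofNat w c) }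
  | .len d, s => some { s with reg := Function.update s.reg d (BitVec.ofNat w n) }
  | .mov d a, s => some { s with reg := Function.update s.reg d (s.reg a) }
  | .bin op d a b, s =>
      some { s with reg := Function.update s.reg d (op.eval (s.reg a) (s.reg b)) }
  | .load d a, s =>
      if h : (s.reg a).toNat < n then
        some { s with reg := Function.update s.reg d (s.arr ⟨(s.reg a).toNat, h⟩) }
      else none
  | .store a b, s =>
      if h : (s.reg a).toNat < n then
        some { s with arr := Function.update s.arr ⟨(s.reg a).toNat, h⟩ (s.reg b) }
      else none

/-- The outcome of an elementary test on the input string `S`; `none` if the string is accessed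
out of bounds. -/
def Test.run {α : Type*} [LinearOrder α] {k w : ℕ} (S : List α) :
    Test k → State k w S.length → Option Bool
  | .eq a b, s => some (decide (s.reg a = s.reg b))
  | .lt a b, s => some (decide ((s.reg a).toNat < (s.reg b).toNat))
  | .symEq a b, s =>
      if h : (s.reg a).toNat < S.length ∧ (s.reg b).toNat < S.length then
        some (decide (S[(s.reg a).toNat]'h.1 = S[(s.reg b).toNat]'h.2))
      else none
  | .symLt a b, s =>
      if h : (s.reg a).toNat < S.length ∧ (s.reg b).toNat < S.length then
        some (decide (S[(s.reg a).toNat]'h.1 < S[(s.reg b).toNat]'h.2))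
      else none

/-- `Exec S P s t s'`: on the input string `S`, the program `P`, started in the state `s`, halts
after `t` steps in the state `s'`. Each execution of an elementary instruction and each evaluation
of a test takes one step. A program that accesses the string or the array out of bounds, or that
runs forever, has no final state. -/
inductive Exec {α : Type*} [LinearOrder α] {k w : ℕ} (S : List α) :
    Prog k → State k w S.length → ℕ → State k w S.length → Prop
  | instr {i : Instr k} {s s' : State k w S.length} (h : i.run s = some s') :
      Exec S (.instr i) s 1 s'
  | seq {p q : Prog k} {s s₁ s₂ : State k w S.length} {t₁ t₂ : ℕ}
      (hp : Exec S p s t₁ s₁) (hq : Exec S q s₁ t₂ s₂) :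
      Exec S (.seq p q) s (t₁ + t₂) s₂
  | iteTrue {b : Test k} {p q : Prog k} {s s' : State k w S.length} {t : ℕ}
      (hb : b.run S s = some true) (hp : Exec S p s t s') :
      Exec S (.ite b p q) s (1 + t) s'
  | iteFalse {b : Test k} {p q : Prog k} {s s' : State k w S.length} {t : ℕ}
      (hb : b.run S s = some false) (hq : Exec S q s t s') :
      Exec S (.ite b p q) s (1 + t) s'
  | whileFalse {b : Test k} {p : Prog k} {s : State k w S.length}
      (hb : b.run S s = some false) :
      Exec S (.while b p) s 1 s
  | whileTrue {b : Test k} {p : Prog k} {s s₁ s₂ : State k w S.length} {t₁ t₂ : ℕ}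
      (hb : b.run S s = some true) (hp : Exec S p s t₁ s₁)
      (hw : Exec S (.while b p) s₁ t₂ s₂) :
      Exec S (.while b p) s (1 + t₁ + t₂) s₂

end WordRAM

/-!
The longest Lyndon word that starts at a position `x` ends at the next smaller suffix of `x`, the
first position after `x` whose suffix is smaller (`isLyndonArray_of_isNss`). All next smaller
suffixes are found by a scan from left to right that keeps a stack of the positions whose next
smaller suffix is still unknown. At a position `i` all larger suffixes are removed from the stack;
the top is then the previous smaller suffix of `i`, and `i` is put on the stack. The stack needs no
memory of its own, because each of its elements can keep a link to the next element in the entry of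
the array that it does not need yet (`Scan`).

It remains to bound the time of the comparisons. Three ideas are used.

* Comparisons with successive elements of the stack start from the number `l` of symbols that `i`
  has in common with the last one. Whether the next element shares these symbols as well is decided
  by the Lyndon period of the word at `i` (`LynPeriod.agree_iff`), which is computed on the fly; the
  part that is compared is paid for by the potential `pot` of the stack, and all other comparisons
  at `i` take time proportional to the final `l` (`findPrev_wp`).
* If the `l` symbols shared with some `j < i` cover the Lyndon word from `j` to `i` twice, the
  string has a run there. The array is copied along the run, with `i` moving on by at least `l / 3`
  (`Scan.run_inc`, `Scan.run_dec`, `copyRun_wp`).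
* Otherwise the first `l` symbols at `i`, or a fixed fraction of them, are a disjoint copy of the
  word at `j`, where the array is known already. The entries are copied to `i` for the first quarter
  (`Window.scan`), as long as no comparison among them depends on symbols behind the copy. Such a
  comparison belongs to a Lyndon word that is repeated up to the end of the copy, and there is only
  one candidate for it, up to multiples of the period; it is found in linear time from the least
  suffix of the second quarter and the next one (`root_of_period`, `Root.not_agree`). If the copying
  stops early for this reason, then a long run starts there, and the next step, which copies this
  run, pays for the time (`Repeats`, `scanAll_wp`).

The program is verified with weakest preconditions that count steps (`Prog.wp_sound`). The string is
extended by a least symbol behind its end (`padded`), so that different suffixes always differ in a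
symbol.
-/

/-! ### Weakest preconditions for programs -/

namespace WordRAM

/-- The numbers in the memory of a machine with 19 registers: the registers from `3` on, named by
letters, the array `A`, and the number `tm` of steps done so far. The registers `0`, `1` and `2`
always hold `0`, `1` and the length of the string, and are not recorded.

Throughout the scan, `i` is the position that is processed, `t` is the position after the top of the
stack, `j` is an earlier position whose suffix shares its first `l` symbols with that at `i`, and
`d` is their distance. During the search at `i`, `z` is the top of the stack, `c` its entry in the
array, `p` the Lyndon period of the first `m` symbols at `i`, and `g` says that the search goes on.
When a word is copied, `h` is a quarter of its length, and `c` and `p` describe the Lyndon word that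
may be repeated up to its end. The others are auxiliary. -/
structure View : Type where
  i : ℕ
  t : ℕ
  j : ℕ
  d : ℕ
  l : ℕ
  p : ℕ
  m : ℕ
  z : ℕ
  c : ℕ
  a : ℕ
  b : ℕ
  x : ℕ
  y : ℕ
  g : ℕ
  e : ℕ
  h : ℕ
  A : ℕ → ℕ
  tm : ℕ

/-! The registers: `rZero`, `rOne` and `rN` hold constants, the others the fields of a `View`. -/

abbrev rZero : Fin 19 := 0
abbrev rOne : Fin 19 := 1
abbrev rN : Fin 19 := 2
abbrev rI : Fin 19 := 3
abbrev rT : Fin 19 := 4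
abbrev rJ : Fin 19 := 5
abbrev rD : Fin 19 := 6
abbrev rL : Fin 19 := 7
abbrev rP : Fin 19 := 8
abbrev rM : Fin 19 := 9
abbrev rZ : Fin 19 := 10
abbrev rC : Fin 19 := 11
abbrev rA : Fin 19 := 12
abbrev rB : Fin 19 := 13
abbrev rX : Fin 19 := 14
abbrev rY : Fin 19 := 15
abbrev rG : Fin 19 := 16
abbrev rE : Fin 19 := 17
abbrev rH : Fin 19 := 18

/-- The content of a register. -/
def View.get (n : ℕ) (v : View) : Fin 19 → ℕ
  | 0 => 0 | 1 => 1 | 2 => n | 3 => v.i | 4 => v.t | 5 => v.j | 6 => v.d | 7 => v.l | 8 => v.p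
  | 9 => v.m | 10 => v.z | 11 => v.c | 12 => v.a | 13 => v.b | 14 => v.x | 15 => v.y | 16 => v.g
  | 17 => v.e | _ => v.h

/-- Changes the content of a register, except for the registers that hold constants. -/
def View.set (v : View) (r : Fin 19) (u : ℕ) : View :=
  match r with
  | 3 => { v with i := u } | 4 => { v with t := u } | 5 => { v with j := u }
  | 6 => { v with d := u } | 7 => { v with l := u } | 8 => { v with p := u }
  | 9 => { v with m := u } | 10 => { v with z := u } | 11 => { v with c := u }
  | 12 => { v with a := u } | 13 => { v with b := u } | 14 => { v with x := u }
  | 15 => { v with y := u } | 16 => { v with g := u } | 17 => { v with e := u }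
  | 18 => { v with h := u } | _ => v

/-- Counts one step. -/
def View.tick (v : View) : View := { v with tm := v.tm + 1 }

theorem View.get_set (n : ℕ) (v : View) (r : Fin 19) (hr : 3 ≤ r) (u : ℕ) :
    (v.set r u).get n = Function.update (v.get n) r u := by
  funext q
  fin_cases r <;> first | (exact absurd hr (by decide)) | (fin_cases q <;> rfl)

theorem View.arr_set (v : View) (r : Fin 19) (u : ℕ) : (v.set r u).A = v.A := by
  fin_cases r <;> rfl

theorem View.tm_set (v : View) (r : Fin 19) (u : ℕ) : (v.set r u).tm = v.tm := by
  fin_cases r <;> rfl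

/-- The state `s` holds the numbers recorded in `v`. -/
def View.Rep {w n : ℕ} (v : View) (s : State 19 w n) : Prop :=
  (∀ r, (s.reg r).toNat = v.get n r) ∧ ∀ x : Fin n, (s.arr x).toNat = v.A x

/-- A precondition of an instruction, as a statement about natural numbers: the instruction does not
write to a register that holds a constant, no operation leaves the range from `0` to the
length `n` of the string, which is all that is known to fit in a word, no array access is out of
bounds, and `Q` holds afterwards. The instructions that load constants, and some operations, are not
covered: their precondition is `False`. -/
def Instr.wp (n : ℕ) (Q : View → Prop) (v : View) : Instr 19 → Prop
  | .nop => Q v.tick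
  | .mov r a => 3 ≤ r ∧ Q (v.set r (v.get n a)).tick
  | .bin .add r a b =>
      3 ≤ r ∧ v.get n a + v.get n b ≤ n ∧ Q (v.set r (v.get n a + v.get n b)).tick
  | .bin .sub r a b =>
      3 ≤ r ∧ v.get n b ≤ v.get n a ∧ Q (v.set r (v.get n a - v.get n b)).tick
  | .bin .shr r a b => 3 ≤ r ∧ Q (v.set r (v.get n a / 2 ^ v.get n b)).tick
  | .load r a => 3 ≤ r ∧ v.get n a < n ∧ Q (v.set r (v.A (v.get n a))).tick
  | .store a b =>
      v.get n a < n ∧ Q { v with A := Function.update v.A (v.get n a) (v.get n b), tm := v.tm + 1 }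
  | _ => False

/-- The test does not access the string out of bounds. -/
def Test.safe (n : ℕ) (v : View) : Test 19 → Prop
  | .eq _ _ => True
  | .lt _ _ => True
  | .symEq a b => v.get n a < n ∧ v.get n b < n
  | .symLt a b => v.get n a < n ∧ v.get n b < n

/-- The truth of a test on the string `f`. -/
def Test.holds {β : Type*} [LinearOrder β] (f : ℕ → β) (n : ℕ) (v : View) : Test 19 → Prop
  | .eq a b => v.get n a = v.get n b
  | .lt a b => v.get n a < v.get n b
  | .symEq a b => f (v.get n a) = f (v.get n b)
  | .symLt a b => f (v.get n a) < f (v.get n b)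

/-- A precondition under which a program halts without access out of bounds, and `Q` holds at the
end: a loop needs an invariant `I`
and a measure `μ` that decreases. -/
def Prog.wp {β : Type*} [LinearOrder β] (f : ℕ → β) (n : ℕ) :
    Prog 19 → (View → Prop) → View → Prop
  | .instr I, Q, v => I.wp n Q v
  | .seq p q, Q, v => p.wp f n (q.wp f n Q) v
  | .ite b p q, Q, v => b.safe n v ∧ (b.holds f n v → p.wp f n Q v.tick) ∧
      (¬ b.holds f n v → q.wp f n Q v.tick)
  | .while b p, Q, v => ∃ (I : View → Prop) (μ : View → ℕ), I v ∧ ∀ u, I u → b.safe n u ∧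
      (b.holds f n u → p.wp f n (fun u' => I u' ∧ μ u' < μ u) u.tick) ∧
      (¬ b.holds f n u → Q u.tick)

variable {α : Type*} [LinearOrder α]

/-- The string `S`, extended beyond its end by a symbol smaller than all others. -/
def padded (S : List α) (x : ℕ) : WithBot α := if h : x < S.length then (S[x] : α) else ⊥

theorem View.Rep.tick {w n : ℕ} {v : View} {s : State 19 w n} (h : v.Rep s) : v.tick.Rep s := h

theorem View.Rep.set {w n : ℕ} {v : View} {s : State 19 w n} (h : v.Rep s) {r : Fin 19}
    (hr : 3 ≤ r) {u : BitVec w} {k : ℕ} (hu : u.toNat = k) :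
    ((v.set r k).tick).Rep { s with reg := Function.update s.reg r u } := by
  refine ⟨fun q => ?_, fun x => ?_⟩
  · change _ = (v.set r k).get n q
    rw [View.get_set n v r hr]
    by_cases hq : q = r
    · subst hq; simpa using hu
    · simpa [Function.update_of_ne hq] using h.1 q
  · change _ = (v.set r k).A x
    rw [View.arr_set]; exact h.2 x

theorem Instr.wp_sound {w : ℕ} {n : ℕ} (hn : n < 2 ^ w) {Q : View → Prop} {v : View}
    {s : State 19 w n} (hs : v.Rep s) (I : Instr 19) (hI : I.wp n Q v) :
    ∃ s' v', I.run s = some s' ∧ v'.Rep s' ∧ v'.tm = v.tm + 1 ∧ Q v' := by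
  cases I with
  | nop => exact ⟨s, v.tick, rfl, hs, rfl, hI⟩
  | const r c => exact hI.elim
  | len r => exact hI.elim
  | mov r a =>
    exact ⟨_, _, rfl, hs.set hI.1 (hs.1 a), by simp [View.tick, View.tm_set], hI.2⟩
  | bin op r a b =>
    cases op with
    | add =>
      refine ⟨_, _, rfl, hs.set hI.1 ?_, by simp [View.tick, View.tm_set], hI.2.2⟩
      simp only [BinOp.eval, BitVec.toNat_add, hs.1]
      exact Nat.mod_eq_of_lt (lt_of_le_of_lt hI.2.1 hn)
    | sub =>
      refine ⟨_, _, rfl, hs.set hI.1 ?_, by simp [View.tick, View.tm_set], hI.2.2⟩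
      have h1 : s.reg b ≤ s.reg a := by rw [BitVec.le_def, hs.1, hs.1]; exact hI.2.1
      simp only [BinOp.eval, BitVec.toNat_sub_of_le h1, hs.1]
    | shr =>
      refine ⟨_, _, rfl, hs.set hI.1 ?_, by simp [View.tick, View.tm_set], hI.2⟩
      simp only [BinOp.eval, BitVec.toNat_ushiftRight, hs.1, Nat.shiftRight_eq_div_pow]
    | _ => exact hI.elim
  | load r a =>
    obtain ⟨h1, h2, h3⟩ := hI
    rw [← hs.1 a] at h2
    refine ⟨_, _, by simp only [Instr.run, dif_pos h2]; rfl, hs.set h1 ?_,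
      by simp [View.tick, View.tm_set], h3⟩
    rw [hs.2]; simp [hs.1]
  | store a b =>
    obtain ⟨h2, h3⟩ := hI
    have h2' := h2
    rw [← hs.1 a] at h2
    refine ⟨{ s with arr := Function.update s.arr ⟨_, h2⟩ (s.reg b) },
      { v with A := Function.update v.A (v.get n a) (v.get n b), tm := v.tm + 1 },
      by simp only [Instr.run, dif_pos h2], ⟨hs.1, fun x => ?_⟩, rfl, h3⟩
    simp only [Function.update_apply, Fin.ext_iff, hs.1]
    split_ifs <;> simp [hs.1, hs.2]

theorem Test.run_eq {w : ℕ} {S : List α} {v : View} {s : State 19 w S.length} (hs : v.Rep s)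
    (b : Test 19) (hb : b.safe S.length v) :
    (b.holds (padded S) S.length v → b.run S s = some true) ∧
      (¬ b.holds (padded S) S.length v → b.run S s = some false) := by
  cases b with
  | eq a b => simp [Test.holds, Test.run, BitVec.toNat_inj.symm, hs.1]
  | lt a b => simp [Test.holds, Test.run, hs.1]
  | symEq a b =>
    simp only [Test.safe] at hb
    simp [Test.holds, Test.run, hs.1, padded, hb.1, hb.2]
  | symLt a b =>
    simp only [Test.safe] at hb
    simp [Test.holds, Test.run, hs.1, padded, hb.1, hb.2]

/-- A program that satisfies its precondition halts, and the steps of its execution are those that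
are counted in `tm`. -/
theorem Prog.wp_sound {w : ℕ} {S : List α} (hn : S.length < 2 ^ w) (P : Prog 19)
    {Q : View → Prop} {v : View} {s : State 19 w S.length} (hs : v.Rep s)
    (hP : P.wp (padded S) S.length Q v) :
    ∃ t s' v', Exec S P s t s' ∧ v'.Rep s' ∧ v'.tm = v.tm + t ∧ Q v' := by
  induction P generalizing Q v s with
  | instr I =>
    obtain ⟨s', v', h1, h2, h3, h4⟩ := Instr.wp_sound hn hs I hP
    exact ⟨1, s', v', .instr h1, h2, h3, h4⟩
  | seq p q ihp ihq =>
    obtain ⟨t₁, s₁, v₁, h1, h2, h3, h4⟩ := ihp hs hP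
    obtain ⟨t₂, s₂, v₂, k1, k2, k3, k4⟩ := ihq h2 h4
    exact ⟨t₁ + t₂, s₂, v₂, .seq h1 k1, k2, by omega, k4⟩
  | ite b p q ihp ihq =>
    obtain ⟨hb, h1, h2⟩ := hP
    by_cases hv : b.holds (padded S) S.length v
    · obtain ⟨t, s', v', k1, k2, k3, k4⟩ := ihp hs.tick (h1 hv)
      exact ⟨1 + t, s', v', .iteTrue ((Test.run_eq hs b hb).1 hv) k1, k2,
        by simp only [View.tick] at k3; omega, k4⟩
    · obtain ⟨t, s', v', k1, k2, k3, k4⟩ := ihq hs.tick (h2 hv)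
      exact ⟨1 + t, s', v', .iteFalse ((Test.run_eq hs b hb).2 hv) k1, k2,
        by simp only [View.tick] at k3; omega, k4⟩
  | _ b p ihp =>
    obtain ⟨I, μ, hI, hu⟩ := hP
    induction hk : μ v using Nat.strong_induction_on generalizing v s with
    | _ k ih =>
      obtain ⟨hb, h1, h2⟩ := hu v hI
      by_cases hv : b.holds (padded S) S.length v
      · obtain ⟨t₁, s₁, v₁, k1, k2, k3, k4, k5⟩ := ihp hs.tick (h1 hv)
        obtain ⟨t₂, s₂, v₂, l1, l2, l3, l4⟩ := ih _ (hk ▸ k5) k2 k4 rfl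
        exact ⟨1 + t₁ + t₂, s₂, v₂, .whileTrue ((Test.run_eq hs b hb).1 hv) k1 l1, l2,
          by simp only [View.tick] at k3; omega, l4⟩
      · exact ⟨1, s, v.tick, .whileFalse ((Test.run_eq hs b hb).2 hv), hs.tick, rfl, h2 hv⟩

end WordRAM

/-! ### Suffixes, Lyndon words and their periods -/

section Suffixes

variable {β : Type*} {f : ℕ → β}

/-- The suffixes that start at `a` and `b` agree in their first `m` symbols. -/
def Agree (f : ℕ → β) (a b m : ℕ) : Prop := ∀ k < m, f (a + k) = f (b + k)

theorem Agree.symm {a b m : ℕ} (h : Agree f a b m) : Agree f b a m := fun k hk => (h k hk).symm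

theorem Agree.mono {a b m m' : ℕ} (h : Agree f a b m) (hm : m' ≤ m) : Agree f a b m' :=
  fun k hk => h k (by omega)

theorem Agree.trans {a b c m : ℕ} (h : Agree f a b m) (h' : Agree f b c m) : Agree f a c m :=
  fun k hk => (h k hk).trans (h' k hk)

theorem Agree.shift {a b m : ℕ} (h : Agree f a b m) {s : ℕ} (hs : s ≤ m) :
    Agree f (a + s) (b + s) (m - s) := fun k hk => by
  have := h (s + k) (by omega)
  rwa [← Nat.add_assoc, ← Nat.add_assoc] at this

theorem Agree.succ {a b m : ℕ} (h : Agree f a b m) (h' : f (a + m) = f (b + m)) :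
    Agree f a b (m + 1) := fun k hk => by
  rcases Nat.lt_succ_iff_lt_or_eq.1 hk with h1 | rfl
  · exact h k h1
  · exact h'

variable [LinearOrder β]

/-- The suffix that starts at `a` is lexicographically smaller than the one that starts at `b`. -/
def SLt (f : ℕ → β) (a b : ℕ) : Prop := ∃ k, Agree f a b k ∧ f (a + k) < f (b + k)

theorem sLt_iff_of_agree {a b k : ℕ} (h : Agree f a b k) (hk : f (a + k) ≠ f (b + k)) :
    SLt f a b ↔ f (a + k) < f (b + k) := by
  refine ⟨fun ⟨m, h1, h2⟩ => ?_, fun h' => ⟨k, h, h'⟩⟩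
  rcases lt_trichotomy m k with h3 | rfl | h3
  · exact absurd (h m h3) h2.ne
  · exact h2
  · exact absurd (h1 k h3) hk

theorem SLt.asymm {a b : ℕ} (h : SLt f a b) : ¬ SLt f b a := by
  obtain ⟨k, h1, h2⟩ := h
  rw [sLt_iff_of_agree h1.symm h2.ne']
  exact h2.asymm

theorem SLt.trans {a b c : ℕ} (h : SLt f a b) (h' : SLt f b c) : SLt f a c := by
  obtain ⟨k, h1, h2⟩ := h
  obtain ⟨m, h3, h4⟩ := h'
  rcases lt_trichotomy k m with h5 | rfl | h5
  · exact ⟨k, h1.trans (h3.mono h5.le), h2.trans_eq (h3 k h5)⟩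
  · exact ⟨k, h1.trans h3, h2.trans h4⟩
  · exact ⟨m, (h1.mono h5.le).trans h3, (h1 m h5).trans_lt h4⟩

theorem SLt.shift {a b m : ℕ} (h : Agree f a b m) : SLt f (a + m) (b + m) ↔ SLt f a b := by
  constructor
  · rintro ⟨k, h1, h2⟩
    refine ⟨m + k, fun x hx => ?_, by simpa [Nat.add_assoc] using h2⟩
    rcases lt_or_ge x m with h3 | h3
    · exact h x h3
    · have := h1 (x - m) (by omega)
      rwa [show a + m + (x - m) = a + x by omega, show b + m + (x - m) = b + x by omega] at this
  · rintro ⟨k, h1, h2⟩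
    have h3 : m ≤ k := by
      by_contra h3
      exact h2.ne (h k (by omega))
    refine ⟨k - m, h1.shift h3, ?_⟩
    rwa [show a + m + (k - m) = a + k by omega, show b + m + (k - m) = b + k by omega]

/-- The order of two suffixes is decided within a part that occurs elsewhere. -/
theorem SLt.transfer {a b a' b' m : ℕ} (ha : Agree f a a' m) (hb : Agree f b b' m)
    (hm : ¬ Agree f a b m) : SLt f a b ↔ SLt f a' b' := by
  classical
  have hex : ∃ k, k < m ∧ f (a + k) ≠ f (b + k) := by
    unfold Agree at hm; push Not at hm; exact hm
  obtain ⟨h1, h2⟩ := Nat.find_spec hex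
  set k := Nat.find hex
  have h3 : Agree f a b k := fun x hx => by
    by_contra h4
    exact Nat.find_min hex hx ⟨by omega, h4⟩
  have h5 : Agree f a' b' k := fun x hx => by
    rw [← ha x (by omega), ← hb x (by omega)]; exact h3 x hx
  rw [sLt_iff_of_agree h3 h2, sLt_iff_of_agree h5 (by rwa [← ha k h1, ← hb k h1]),
    ← ha k h1, ← hb k h1]

/-- `f` takes its least value from `n` on, and only there. -/
def Padded {γ : Type*} (f : ℕ → WithBot γ) (n : ℕ) : Prop := ∀ x, f x = ⊥ ↔ n ≤ x

end Suffixes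

section Padded

variable {γ : Type*} {f : ℕ → WithBot γ} {n : ℕ}

theorem Padded.agree_le (hf : Padded f n) {a b m : ℕ} (hab : a < b) (hb : b ≤ n)
    (h : Agree f a b m) : b + m ≤ n := by
  by_contra hlt
  have h1 := h (n - b) (by omega)
  have h2 : f (b + (n - b)) = ⊥ := (hf _).2 (by omega)
  rw [h2, hf] at h1
  omega

variable [LinearOrder γ]

theorem Padded.total (hf : Padded f n) {a b : ℕ} (hab : a < b) (hb : b ≤ n) :
    SLt f a b ∨ SLt f b a := by
  classical
  have hex : ∃ k, f (a + k) ≠ f (b + k) := by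
    by_contra h
    push Not at h
    have := hf.agree_le hab hb (m := n + 1) (fun k _ => h k)
    omega
  have h1 := Nat.find_spec hex
  have h2 : Agree f a b (Nat.find hex) := fun k hk => by
    by_contra h3; exact Nat.find_min hex hk h3
  rcases lt_or_gt_of_ne h1 with h3 | h3
  · exact Or.inl ⟨_, h2, h3⟩
  · exact Or.inr ⟨_, h2.symm, h3⟩

theorem Padded.not_sLt (hf : Padded f n) {a b : ℕ} (hab : a ≠ b) (ha : a ≤ n) (hb : b ≤ n) :
    ¬ SLt f a b ↔ SLt f b a := by
  refine ⟨fun h => ?_, fun h => h.asymm⟩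
  rcases lt_or_gt_of_ne hab with h1 | h1
  · exact (hf.total h1 hb).resolve_left h
  · exact (hf.total h1 ha).resolve_right h

theorem Padded.end_sLt (hf : Padded f n) {a : ℕ} (ha : a < n) : SLt f n a := by
  refine ⟨0, fun k hk => by omega, ?_⟩
  rw [(hf (n + 0)).2 (by omega), bot_lt_iff_ne_bot, Ne, hf]
  omega

end Padded

section Blocks

variable {β : Type*} [LinearOrder β] {f : ℕ → β}

/-- The block between the positions `j` and `i` is smaller than each of its proper suffixes, and
differs from it inside the block: the block is a Lyndon word. -/
def Lyn (f : ℕ → β) (j i : ℕ) : Prop :=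
  ∀ x, j < x → x < i → ∃ k, x + k < i ∧ Agree f j x k ∧ f (j + k) < f (x + k)

theorem Lyn.sLt {j i x : ℕ} (h : Lyn f j i) (h1 : j < x) (h2 : x < i) : SLt f j x := by
  obtain ⟨k, _, h3, h4⟩ := h x h1 h2
  exact ⟨k, h3, h4⟩

/-- A block that is preceded by a Lyndon block and starts with the same symbols is smaller than
the proper suffixes of that Lyndon block. -/
theorem Lyn.sLt_of_agree {j i x y m : ℕ} (h : Lyn f j i) (h1 : j < x) (h2 : x < i)
    (hy : Agree f j y m) (hm : i ≤ x + m) : SLt f y x := by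
  obtain ⟨k, h3, h4, h5⟩ := h x h1 h2
  exact ⟨k, (hy.symm.mono (by omega)).trans h4, by rwa [← hy k (by omega)]⟩

theorem Lyn.not_agree {j i x y m : ℕ} (h : Lyn f j i) (h1 : j < x) (h2 : x < i)
    (hy : Agree f j y m) (hm : i ≤ x + m) : ¬ Agree f y x m := by
  obtain ⟨k, h3, h4, h5⟩ := h x h1 h2
  intro h6
  have := h6 k (by omega)
  rw [← hy k (by omega)] at this
  exact h5.ne this

theorem Lyn.transfer {j i j' i' : ℕ} (h : Lyn f j i) (hi : i' - j' = i - j)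
    (ha : Agree f j j' (i - j)) : Lyn f j' i' := by
  intro x hx hxi
  obtain ⟨k, h3, h4, h5⟩ := h (j + (x - j')) (by omega) (by omega)
  have e : ∀ r, x + r < i' → f (x + r) = f (j + (x - j') + r) := fun r hr => by
    have := ha (x - j' + r) (by omega)
    rw [show j' + (x - j' + r) = x + r by omega] at this
    rw [← this, Nat.add_assoc]
  refine ⟨k, by omega, fun r hr => ?_, ?_⟩
  · rw [← ha r (by omega), h4 r hr, e r (by omega)]
  · rw [← ha k (by omega), e k (by omega)]; exact h5

/-- If all suffixes that start inside the block from `j` to `i` are larger than those at `j` and at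
`i`, then the block is a Lyndon word: if the suffix at `x` agreed with that at `j` up to `i`, the
suffix at `i` would be larger than one inside the block. -/
theorem lyn_of_sLt {j i : ℕ} (h : ∀ x, j < x → x < i → SLt f j x)
    (h' : ∀ x, j < x → x < i → SLt f i x) : Lyn f j i := by
  intro x hx hxi
  obtain ⟨k, h1, h2⟩ := h x hx hxi
  refine ⟨k, ?_, h1, h2⟩
  by_contra hk
  have h3 : SLt f (j + (i - x)) (x + (i - x)) :=
    (SLt.shift (h1.mono (by omega))).2 (h x hx hxi)
  rw [show x + (i - x) = i by omega] at h3
  exact h3.asymm (h' _ (by omega) (by omega))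

/-- A Lyndon word has no border: two Lyndon prefixes that are periods of the same word are
equal. -/
theorem Lyn.period_unique {a d p l : ℕ} (hd : Lyn f a (a + d)) (hp : Lyn f a (a + p))
    (hd0 : 0 < d) (hp0 : 0 < p) (hdl : d ≤ l) (hpl : p ≤ l)
    (ad : Agree f a (a + d) (l - d)) (ap : Agree f a (a + p) (l - p)) : d = p := by
  rcases lt_trichotomy d p with h | h | h
  · obtain ⟨k, h1, h2, h3⟩ := hp (a + d) (by omega) (by omega)
    exact absurd (ad k (by omega)) h3.ne
  · exact h
  · obtain ⟨k, h1, h2, h3⟩ := hd (a + p) (by omega) (by omega)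
    exact absurd (ap k (by omega)) h3.ne

/-- `p` is the length of the longest Lyndon prefix of the word of length `l` at `i`, and a period
of this word. -/
structure LynPeriod (f : ℕ → β) (i l p : ℕ) : Prop where
  pos : 0 < p
  le : p ≤ max l 1
  lyn : Lyn f i (i + p)
  per : Agree f i (i + p) (l - p)

theorem LynPeriod.init (i : ℕ) : LynPeriod f i 0 1 :=
  ⟨by omega, by omega, fun x h1 h2 => by omega, fun k hk => by omega⟩

theorem LynPeriod.succ_of_lt {i l p : ℕ} (h : LynPeriod f i l p) (hl : l < p) :
    LynPeriod f i (l + 1) p :=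
  ⟨h.pos, by have := h.le; omega, h.lyn, fun k hk => by omega⟩

theorem LynPeriod.succ_of_eq {i l p : ℕ} (h : LynPeriod f i l p) (hl : p ≤ l)
    (he : f (i + l - p) = f (i + l)) : LynPeriod f i (l + 1) p := by
  refine ⟨h.pos, by omega, h.lyn, ?_⟩
  rw [show l + 1 - p = l - p + 1 by omega]
  refine h.per.succ ?_
  rwa [show i + (l - p) = i + l - p by omega, show i + p + (l - p) = i + l by omega]

/-- The word at `i` repeats with its Lyndon period. -/
theorem LynPeriod.mod {i l p : ℕ} (h : LynPeriod f i l p) {a b : ℕ} (hab : a + p * b < l) :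
    f (i + (a + p * b)) = f (i + a) := by
  induction b with
  | zero => simp
  | succ b ih =>
    have e : p * (b + 1) = p * b + p := by ring
    rw [e] at hab ⊢
    have := h.per (a + p * b) (by omega)
    rw [show i + p + (a + p * b) = i + (a + (p * b + p)) by ring] at this
    rw [← this, ih (by omega)]

/-- Duval's step: a word that is a prefix of a power of a Lyndon word becomes a Lyndon word when a
symbol is appended that is larger than the one that would continue the power. -/
theorem LynPeriod.succ_of_gt {i l p : ℕ} (h : LynPeriod f i l p) (hl : p ≤ l)
    (he : f (i + l - p) < f (i + l)) : LynPeriod f i (l + 1) (l + 1) := by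
  refine ⟨by omega, by omega, ?_, fun k hk => by omega⟩
  intro x hx hxl
  have hp := h.pos
  obtain ⟨y, rfl⟩ : ∃ y, x = i + y := ⟨x - i, by omega⟩
  have hdm := Nat.mod_add_div y p
  have hlt := Nat.mod_lt y hp
  set r := y % p
  set q := y / p
  have hq : p ≤ y → 1 ≤ q := fun h => Nat.div_pos h hp
  -- the symbol expected at the end, seen from the suffix at `y`
  have hend : ∀ u, y + u = l → 0 < y → r + u < p ∨ r = 0 → f (i + l - p) = f (i + (r + u)) := by
    intro u hu hy h1
    have h2 : 1 ≤ q := hq (by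
      by_contra h3
      have : r = y := Nat.mod_eq_of_lt (by omega)
      omega)
    obtain ⟨q', hq'⟩ : ∃ q', q = q' + 1 := ⟨q - 1, by omega⟩
    have e : p * q = p * q' + p := by rw [hq']; ring
    have := h.mod (a := r + u) (b := q') (by omega)
    rw [← this]; congr 1; omega
  by_cases hr : r = 0
  · refine ⟨l - y, by omega, fun k hk => ?_, ?_⟩
    · have := h.mod (a := k) (b := q) (by omega)
      rw [← this]; congr 1; omega
    · have := hend (l - y) (by omega) (by omega) (Or.inr hr)
      rw [hr] at this
      rw [show i + (l - y) = i + (0 + (l - y)) by omega, ← this,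
        show i + y + (l - y) = i + l by omega]
      exact he
  · obtain ⟨k, h1, h2, h3⟩ := h.lyn (i + r) (by omega) (by omega)
    have e : ∀ s, r + s < p → y + s < l → f (i + y + s) = f (i + r + s) := fun s hs hsl => by
      have := h.mod (a := r + s) (b := q) (by omega)
      rw [Nat.add_assoc i r s, ← this]; congr 1; omega
    rcases lt_trichotomy (y + k) l with h4 | h4 | h4
    · refine ⟨k, by omega, fun s hs => ?_, ?_⟩
      · rw [h2 s hs, e s (by omega) (by omega)]
      · rw [e k (by omega) (by omega)]; exact h3
    · refine ⟨k, by omega, fun s hs => ?_, ?_⟩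
      · rw [h2 s hs, e s (by omega) (by omega)]
      · have := hend k h4 (by omega) (Or.inl (by omega))
        rw [show i + y + k = i + l by omega]
        rw [← Nat.add_assoc] at this
        exact h3.trans (this ▸ he)
    · refine ⟨l - y, by omega, fun s hs => ?_, ?_⟩
      · rw [h2 s (by omega), e s (by omega) (by omega)]
      · have := hend (l - y) (by omega) (by omega) (Or.inl (by omega))
        rw [show i + y + (l - y) = i + l by omega, h2 (l - y) (by omega)]
        rw [← Nat.add_assoc] at this
        rw [← this]; exact he

end Blocks

/-! ### Previous and next smaller suffixes, and the stack -/

section Scan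

variable {γ : Type*} [LinearOrder γ] {f : ℕ → WithBot γ} {n : ℕ}

open Classical in
/-- The position after the previous smaller suffix of `x`, and `0` if no suffix that starts before
`x` is smaller. -/
noncomputable def prevEnd (f : ℕ → WithBot γ) (x : ℕ) : ℕ :=
  Nat.findGreatest (fun y => 0 < y ∧ SLt f (y - 1) x) x

/-- `y` is the next smaller suffix of `x`. -/
structure IsNss (f : ℕ → WithBot γ) (x y : ℕ) : Prop where
  lt : x < y
  sLt : SLt f y x
  between : ∀ z, x < z → z < y → SLt f x z

open Classical in
theorem prevEnd_le (x : ℕ) : prevEnd f x ≤ x := Nat.findGreatest_le _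

open Classical in
theorem sLt_of_prevEnd {x y : ℕ} (h : y + 1 = prevEnd f x) : SLt f y x := by
  have := Nat.findGreatest_of_ne_zero (P := fun y => 0 < y ∧ SLt f (y - 1) x) h.symm (by omega)
  simpa using this.2

open Classical in
theorem not_sLt_of_prevEnd_le {x z : ℕ} (h : prevEnd f x ≤ z) (hz : z < x) : ¬ SLt f z x := by
  intro h'
  exact Nat.findGreatest_is_greatest (P := fun y => 0 < y ∧ SLt f (y - 1) x) (n := x) (k := z + 1)
    (Nat.lt_succ_of_le h) hz ⟨by omega, by simpa using h'⟩

theorem prevEnd_eq {x t : ℕ} (h : t ≤ x) (h1 : ∀ z, z + 1 = t → SLt f z x)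
    (h2 : ∀ z, t ≤ z → z < x → ¬ SLt f z x) : prevEnd f x = t := by
  have hle : prevEnd f x ≤ t := by
    by_contra hlt
    obtain ⟨y, hy⟩ : ∃ y, y + 1 = prevEnd f x := ⟨prevEnd f x - 1, by omega⟩
    have := prevEnd_le (f := f) x
    exact h2 y (by omega) (by omega) (sLt_of_prevEnd hy)
  rcases Nat.eq_zero_or_pos t with h3 | h3
  · omega
  · by_contra h4
    exact not_sLt_of_prevEnd_le (z := t - 1) (by omega) (by omega) (h1 _ (by omega))

open Classical in
/-- The number of symbols that `x` has in common with its previous smaller suffix, up to the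
distance of the two, and `0` if there is no previous smaller suffix. -/
noncomputable def overlap (f : ℕ → WithBot γ) (x : ℕ) : ℕ :=
  if prevEnd f x = 0 then 0
  else Nat.findGreatest (fun m => Agree f (prevEnd f x - 1) x m) (x + 1 - prevEnd f x)

open Classical in
theorem overlap_le (x : ℕ) : overlap f x ≤ x + 1 - prevEnd f x := by
  unfold overlap
  split_ifs
  · omega
  · exact Nat.findGreatest_le _

open Classical in
theorem le_overlap {x y m : ℕ} (h : y + 1 = prevEnd f x) (hm : m ≤ x - y) (ha : Agree f y x m) :
    m ≤ overlap f x := by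
  unfold overlap
  rw [if_neg (by omega), ← h]
  exact Nat.le_findGreatest (by omega) (by simpa using ha)

open Classical in
theorem overlap_le_of_not_agree {x m : ℕ}
    (h : ∀ y, y + 1 = prevEnd f x → ¬ Agree f y x (m + 1)) : overlap f x ≤ m := by
  unfold overlap
  split_ifs with h0
  · omega
  · by_contra hlt
    obtain ⟨y, hy⟩ : ∃ y, y + 1 = prevEnd f x := ⟨prevEnd f x - 1, by omega⟩
    refine h y hy ?_
    have := Nat.findGreatest_spec (P := fun m => Agree f (prevEnd f x - 1) x m)
      (n := x + 1 - prevEnd f x) (m := 0) (by omega) (fun k hk => by omega)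
    rw [show y = prevEnd f x - 1 by omega]
    exact Agree.mono this (by omega)

/-- The potential of the stack whose top is `t - 1`: each element contributes its overlap with the
next one. -/
noncomputable def pot (f : ℕ → WithBot γ) : ℕ → ℕ
  | 0 => 0
  | z + 1 => 1 + overlap f z + pot f (prevEnd f z)
decreasing_by exact Nat.lt_succ_of_le (prevEnd_le z)

theorem pot_zero : pot f 0 = 0 := by rw [pot]

theorem pot_succ (z : ℕ) : pot f (z + 1) = 1 + overlap f z + pot f (prevEnd f z) := by rw [pot]

/-- The state of the scan before position `i`. A position `x < t` is on the stack if no suffix that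
starts between `x` and `i` is smaller; `t - 1` is the top of the stack, and `t = 0` says that the
stack is empty. The array holds the distance to the next smaller suffix, and for the elements of
the stack the distance to the previous smaller suffix, which is the next element of the stack
(the bottom of the stack is linked to an imaginary position before the string). -/
structure Scan (f : ℕ → WithBot γ) (n i t : ℕ) (A : ℕ → ℕ) : Prop where
  t_le : t ≤ i
  i_le : i ≤ n
  top : ∀ z, z + 1 = t → ∀ y, z < y → y < i → SLt f z y
  gap : ∀ x, t ≤ x → x < i → SLt f i x
  opened : ∀ x, x < t → (∀ y, x < y → y < i → SLt f x y) → A x = x + 1 - prevEnd f x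
  closed : ∀ x, x < i → (t ≤ x ∨ ∃ y, x < y ∧ y < i ∧ SLt f y x) → IsNss f x (x + A x)

theorem Scan.init (A : ℕ → ℕ) : Scan f n 0 0 A :=
  ⟨le_rfl, by omega, by omega, by omega, by omega, by omega⟩

theorem Scan.arr_top {i z : ℕ} {A : ℕ → ℕ} (h : Scan f n i (z + 1) A) :
    A z = z + 1 - prevEnd f z := h.opened z (by omega) (h.top z rfl)

/-- Removing the top of the stack when the suffix at `i` is smaller. -/
theorem Scan.pop (hf : Padded f n) {i z : ℕ} {A : ℕ → ℕ} (h : Scan f n i (z + 1) A)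
    (hz : SLt f i z) : Scan f n i (prevEnd f z) (Function.update A z (i - z)) := by
  have hle := prevEnd_le (f := f) z
  have hti := h.t_le
  have hin := h.i_le
  have hgap : ∀ x, prevEnd f z ≤ x → x < z → SLt f z x := fun x h1 h2 =>
    (hf.not_sLt (by omega) (by omega) (by omega)).1 (not_sLt_of_prevEnd_le h1 h2)
  refine ⟨by omega, hin, ?_, ?_, ?_, ?_⟩
  · intro y hy w h1 h2
    have h3 := sLt_of_prevEnd hy
    rcases lt_trichotomy w z with h4 | rfl | h4
    · exact h3.trans (hgap w (by omega) h4)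
    · exact h3
    · exact h3.trans (h.top z rfl w h4 h2)
  · intro x h1 h2
    rcases lt_trichotomy x z with h4 | rfl | h4
    · exact hz.trans (hgap x h1 h4)
    · exact hz
    · exact h.gap x (by omega) h2
  · intro x h1 h2
    rw [Function.update_of_ne (by omega)]
    exact h.opened x (by omega) h2
  · intro x h1 h2
    rcases eq_or_ne x z with rfl | h4
    · rw [Function.update_self, show x + (i - x) = i by omega]
      exact ⟨by omega, hz, h.top x rfl⟩
    · rw [Function.update_of_ne h4]
      refine h.closed x h1 ?_
      rcases h2 with h2 | h2
      · rcases lt_or_gt_of_ne h4 with h5 | h5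
        · exact Or.inr ⟨z, h5, by omega, hgap x h2 h5⟩
        · exact Or.inl h5
      · exact Or.inr h2

theorem Scan.prevEnd_eq {i t : ℕ} {A : ℕ → ℕ} (h : Scan f n i t A)
    (ht : ∀ z, z + 1 = t → SLt f z i) : prevEnd f i = t :=
  _root_.prevEnd_eq h.t_le ht fun z h1 h2 => (h.gap z h1 h2).asymm

/-- Adding `i` to the stack when all larger suffixes have been removed. -/
theorem Scan.push (hf : Padded f n) {i t : ℕ} {A : ℕ → ℕ} (h : Scan f n i t A) (hi : i < n)
    (ht : ∀ z, z + 1 = t → SLt f z i) :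
    Scan f n (i + 1) (i + 1) (Function.update A i (i + 1 - t)) := by
  have hp := h.prevEnd_eq ht
  refine ⟨le_rfl, hi, by omega, by omega, ?_, ?_⟩
  · intro x h1 h2
    rcases eq_or_ne x i with rfl | h3
    · rw [Function.update_self, hp]
    · rw [Function.update_of_ne h3]
      have h4 : x < t := by
        by_contra h4
        exact (h2 i (by omega) (by omega)).asymm (h.gap x (by omega) (by omega))
      exact h.opened x h4 fun y h5 h6 => h2 y h5 (by omega)
  · intro x h1 h2
    obtain ⟨y, hy1, hy2, hy3⟩ := h2.resolve_left (by omega)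
    rw [Function.update_of_ne (by omega)]
    refine h.closed x (by omega) ?_
    by_contra hno
    push Not at hno
    obtain ⟨h4, h5⟩ := hno
    have h6 : ∀ y, x < y → y < i → SLt f x y := fun w hw1 hw2 => by
      have := h.i_le
      exact (hf.not_sLt (by omega) (by omega) (by omega)).1 (h5 w hw1 hw2)
    rcases eq_or_ne y i with rfl | h7
    · have h8 := ht (t - 1) (by omega)
      rcases eq_or_ne x (t - 1) with rfl | h9
      · exact h8.asymm hy3
      · have := h.t_le
        exact ((h6 (t - 1) (by omega) (by omega)).trans h8).asymm hy3
    · exact h5 y hy1 (by omega) hy3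

theorem Scan.lyn_top {i z : ℕ} {A : ℕ → ℕ} (h : Scan f n i (z + 1) A) : Lyn f z i :=
  lyn_of_sLt (h.top z rfl) fun x h1 h2 => h.gap x h1 h2

theorem lyn_of_prevEnd (hf : Padded f n) {y z : ℕ} (hz : z ≤ n) (h : y + 1 = prevEnd f z) :
    Lyn f y z := by
  have h1 : ∀ x, y < x → x < z → SLt f z x := fun x h2 h3 =>
    (hf.not_sLt (by omega) (by omega) (by omega)).1 (not_sLt_of_prevEnd_le (by omega) h3)
  exact lyn_of_sLt (fun x h2 h3 => (sLt_of_prevEnd h).trans (h1 x h2 h3)) h1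

/-- A position between two positions of which the second closes it. -/
theorem IsNss.le_of_sLt {x y z : ℕ} (h : IsNss f x y) (h1 : x < z) (h2 : SLt f z x) : y ≤ z := by
  by_contra h3
  exact (h.between z h1 (by omega)).asymm h2

end Scan

/-! ### Runs of a Lyndon word -/

section Repetitions

variable {γ : Type*} {f : ℕ → WithBot γ} {n : ℕ}

/-- If the `l` symbols at `j + d` continue the word at `j` with period `d`, then so do those after
`r` periods. -/
theorem agree_mul {j d l : ℕ} (ha : Agree f j (j + d) l) (r : ℕ) (hr : r * d ≤ l + d) :
    Agree f j (j + r * d) (l + d - r * d) := by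
  induction r with
  | zero => simp [Agree]
  | succ r ih =>
    have e : (r + 1) * d = r * d + d := by ring
    rw [e] at hr ⊢
    have h1 := ih (by omega)
    have h2 := ha.shift (s := r * d) (by omega)
    rw [show j + d + r * d = j + (r * d + d) by ring] at h2
    exact (h1.mono (by omega)).trans (h2.mono (by omega))

variable [LinearOrder γ]

/-- Inside a square of a Lyndon word, suffixes that start in the first half differ before the end
of the square. -/
theorem Lyn.not_agree_square {j d s z : ℕ} (h : Lyn f j (j + d)) (ha : Agree f j (j + d) d)
    (hs : 0 < s) (hsz : s < z) (hz : z ≤ d) : ¬ Agree f (j + s) (j + z) (2 * d - z) := by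
  intro h1
  have h2 := h1.shift (s := d - z) (by omega)
  rw [show j + z + (d - z) = j + d by omega, show 2 * d - z - (d - z) = d by omega] at h2
  exact h.not_agree (x := j + s + (d - z)) (by omega) (by omega) ha (by omega) h2.symm

/-- The next smaller suffix inside the first half of the square of a Lyndon word is determined by
this square. -/
theorem IsNss.square_transfer {j d r s a : ℕ} (h : Lyn f j (j + d)) (ha : Agree f j (j + d) d)
    (hr : Agree f j r (2 * d)) (hs : 0 < s) (hsa : s + a ≤ d) (hn : IsNss f (j + s) (j + s + a)) :
    IsNss f (r + s) (r + s + a) := by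
  have ha0 := hn.lt
  have key : ∀ z, s < z → z ≤ d → ¬ Agree f (j + s) (j + z) (2 * d - z) ∧
      Agree f (j + s) (r + s) (2 * d - z) ∧ Agree f (j + z) (r + z) (2 * d - z) := fun z h1 h2 =>
    ⟨h.not_agree_square ha hs h1 h2, (hr.shift (s := s) (by omega)).mono (by omega),
      hr.shift (by omega)⟩
  refine ⟨by omega, ?_, fun z h1 h2 => ?_⟩
  · obtain ⟨h1, h2, h3⟩ := key (s + a) (by omega) hsa
    rw [Nat.add_assoc]
    refine (SLt.transfer h3 h2 fun h4 => h1 h4.symm).1 ?_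
    rw [← Nat.add_assoc]; exact hn.sLt
  · obtain ⟨y, rfl⟩ : ∃ y, z = r + y := ⟨z - r, by omega⟩
    obtain ⟨k1, k2, k3⟩ := key y (by omega) (by omega)
    exact (SLt.transfer k2 k3 k1).1 (hn.between _ (by omega) (by omega))

/-- A suffix that starts with a repetition of period `d` and leaves this repetition with a symbol
that is too small is larger than the suffix `d` positions later. -/
theorem sLt_of_break {z j d l g : ℕ} (ha : Agree f j (j + d) l) (hd0 : 0 < d) (hg : g ≤ l)
    (hd : d ≤ g) (hz : Agree f z (j + d) g) (hlt : f (z + g) < f (j + g)) : SLt f (z + d) z := by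
  refine ⟨g - d, fun k hk => ?_, ?_⟩
  · have h1 := hz (d + k) (by omega)
    have h2 := ha (d + k) (by omega)
    have h3 := hz k (by omega)
    rw [Nat.add_assoc, h1, h3, ← h2, Nat.add_assoc]
  · have h3 := hz (g - d) (by omega)
    rw [show z + d + (g - d) = z + g by omega, h3, show j + d + (g - d) = j + g by omega]
    exact hlt

variable {i j d l m t : ℕ} {A A' : ℕ → ℕ}

/-- The values of an array that is copied with period `d`. -/
theorem periodic_copy (hd : 0 < d) (h2 : A' (j + d) = d)
    (h3 : ∀ x, j + d < x → x < j + d + m * d → A' x = A' (x - d)) (r s : ℕ) (hs : s < d)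
    (hr : 1 ≤ r) (hrm : r ≤ m) : A' (j + r * d + s) = if s = 0 then d else A' (j + s) := by
  induction r with
  | zero => omega
  | succ r ih =>
    have e : (r + 1) * d = r * d + d := by ring
    have e' : (r + 1) * d ≤ m * d := Nat.mul_le_mul_right d hrm
    rw [e] at e' ⊢
    rcases Nat.eq_zero_or_pos r with rfl | h0
    · split_ifs with hs0
      · subst hs0; simpa using h2
      · rw [h3 _ (by omega) (by omega)]; congr 1; omega
    · have : d ≤ r * d := Nat.le_mul_of_pos_left d h0
      rw [h3 _ (by omega) (by omega), ← ih h0 (by omega)]; congr 1; omega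

theorem exists_block (hd : 0 < d) {x : ℕ} (hx : j ≤ x) (hxm : x < j + d + m * d) :
    ∃ r s, x = j + r * d + s ∧ s < d ∧ r ≤ m := by
  refine ⟨(x - j) / d, (x - j) % d, ?_, Nat.mod_lt _ hd, ?_⟩
  · have := Nat.mod_add_div (x - j) d
    rw [Nat.mul_comm] at this; omega
  · rw [← Nat.lt_succ_iff, Nat.div_lt_iff_lt_mul hd, Nat.succ_mul]; omega

/-- A repetition of the Lyndon word of length `d` at `j`: the `l` symbols that follow it continue it
with period `d`, which leaves room for `m + 1` further copies. -/
structure Run (f : ℕ → WithBot γ) (j d l m : ℕ) : Prop where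
  pos : 0 < d
  lyn : Lyn f j (j + d)
  agree : Agree f j (j + d) l
  le : (m + 1) * d ≤ l

namespace Run

variable (H : Run f j d l m)
include H

theorem agree_block {r : ℕ} (hr : r ≤ m) : Agree f j (j + r * d) (2 * d) := by
  have h1 : r * d ≤ m * d := Nat.mul_le_mul_right d hr
  have h2 := H.le
  rw [Nat.succ_mul] at h2
  exact (agree_mul H.agree r (by omega)).mono (by omega)

theorem sLt_inner {r s : ℕ} (hr : r ≤ m) (hs : 0 < s) (hsd : s < d) :
    SLt f (j + r * d) (j + r * d + s) := by
  have h := H.lyn.transfer (j' := j + r * d) (i' := j + r * d + d) (by omega)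
    ((H.agree_block hr).mono (by omega))
  exact h.sLt (by omega) (by omega)

theorem next_sLt_inner {r s : ℕ} (hr : r ≤ m) (hs : 0 < s) (hsd : s < d) :
    SLt f (j + (r + 1) * d) (j + r * d + s) := by
  have h := H.lyn.transfer (j' := j + r * d) (i' := j + r * d + d) (by omega)
    ((H.agree_block hr).mono (by omega))
  refine h.sLt_of_agree (m := d) (by omega) (by omega) ?_ (by omega)
  have h1 := (H.agree_block hr).shift (s := d) (by omega)
  have h2 := (H.agree_block (Nat.zero_le m)).shift (s := d) (by omega)
  have h3 := H.le
  rw [Nat.succ_mul] at h3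
  have h4 := H.agree.mono (m' := d) (by omega)
  rw [show j + (r + 1) * d = j + r * d + d by ring]
  exact ((H.agree_block hr).symm.mono (by omega)).trans (h4.trans (h1.mono (by omega)))

/-- Whether the run is increasing or decreasing is the same for all successive copies. -/
theorem sLt_next_iff {r : ℕ} (hr : r ≤ m + 1) :
    (SLt f (j + r * d) (j + (r + 1) * d) ↔ SLt f j (j + d)) ∧
      (SLt f (j + (r + 1) * d) (j + r * d) ↔ SLt f (j + d) j) := by
  have h1 : r * d ≤ (m + 1) * d := Nat.mul_le_mul_right d hr
  have h2 := H.le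
  have h3 := H.agree.mono (m' := r * d) (by omega)
  rw [show j + (r + 1) * d = j + d + r * d by ring]
  exact ⟨SLt.shift h3, SLt.shift h3.symm⟩

theorem sLt_later (h : SLt f j (j + d)) {r r' : ℕ} (hr : r < r') (hr' : r' ≤ m + 1) :
    SLt f (j + r * d) (j + r' * d) := by
  induction r', hr using Nat.le_induction with
  | base => exact (H.sLt_next_iff (by omega)).1.2 h
  | succ k hk ih => exact (ih (by omega)).trans ((H.sLt_next_iff (by omega)).1.2 h)

theorem later_sLt (h : SLt f (j + d) j) {r r' : ℕ} (hr : r < r') (hr' : r' ≤ m + 1) :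
    SLt f (j + r' * d) (j + r * d) := by
  induction r', hr using Nat.le_induction with
  | base => exact (H.sLt_next_iff (by omega)).2.2 h
  | succ k hk ih => exact ((H.sLt_next_iff (by omega)).2.2 h).trans (ih (by omega))

/-- The next smaller suffix of a position inside a copy lies in the same copy or at its end, so it
is the same in all copies. -/
theorem isNss_inner {r s a : ℕ} (hr : r ≤ m) (hs : 0 < s) (hsd : s < d)
    (h : IsNss f (j + s) (j + s + a)) : IsNss f (j + r * d + s) (j + r * d + s + a) := by
  have h1 := H.le
  rw [Nat.succ_mul] at h1
  have h2 := H.next_sLt_inner (Nat.zero_le m) hs hsd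
  simp only [Nat.zero_mul, Nat.add_zero, Nat.zero_add, Nat.one_mul] at h2
  have h3 := h.le_of_sLt (by omega) h2
  exact h.square_transfer H.lyn (H.agree.mono (by omega)) (H.agree_block hr) hs (by omega)

theorem prevEnd_root (h : SLt f j (j + d)) {r : ℕ} (hr : r ≤ m) :
    prevEnd f (j + (r + 1) * d) = j + r * d + 1 := by
  have hd := H.pos
  have e : (r + 1) * d = r * d + d := by ring
  refine prevEnd_eq (by omega) ?_ ?_
  · intro z hz
    obtain rfl : z = j + r * d := by omega
    exact H.sLt_later h (by omega) (by omega)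
  · intro z hz1 hz2
    obtain ⟨s, rfl⟩ : ∃ s, z = j + r * d + s := ⟨z - (j + r * d), by omega⟩
    exact (H.next_sLt_inner hr (by omega) (by omega)).asymm

/-- Each repetition adds at most its length, and one, to the potential of the stack. -/
theorem pot_le (h : SLt f j (j + d)) {r : ℕ} (hr : r ≤ m) :
    pot f (j + r * d + 1) ≤ pot f (j + 1) + 2 * (r * d) := by
  have hd := H.pos
  induction r with
  | zero => simp
  | succ r ih =>
    have h1 := H.prevEnd_root h (r := r) (by omega)
    have h2 := overlap_le (f := f) (j + (r + 1) * d)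
    have h3 := ih (by omega)
    rw [pot_succ, h1]
    rw [h1] at h2
    rw [Nat.succ_mul] at h2 ⊢
    omega

end Run

/-- An increasing run: the starting positions of the repeated Lyndon word stay on the stack. -/
theorem Scan.run_inc (h : Scan f n (j + d) (j + 1) A) (H : Run f j d l m)
    (hlt : SLt f j (j + d)) (hm : 1 ≤ m) (hn : j + d + l ≤ n)
    (h1 : ∀ x < j + d, A' x = A x) (h2 : A' (j + d) = d)
    (h3 : ∀ x, j + d < x → x < j + d + m * d → A' x = A' (x - d)) :
    Scan f n (j + d + m * d) (j + m * d + 1) A' := by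
  have hd := H.pos
  have hl := H.le
  rw [Nat.succ_mul] at hl
  have hmd : d ≤ m * d := Nat.le_mul_of_pos_left d hm
  have hclosed : ∀ r s, r ≤ m → 0 < s → s < d →
      IsNss f (j + r * d + s) (j + r * d + s + A' (j + r * d + s)) := by
    intro r s hr hs hsd
    have hA : A' (j + r * d + s) = A (j + s) := by
      rcases Nat.eq_zero_or_pos r with rfl | h0
      · rw [← h1 (j + s) (by omega)]; congr 1; omega
      · rw [periodic_copy hd h2 h3 r s hsd h0 hr, if_neg (by omega), h1 _ (by omega)]
    rw [hA]
    exact H.isNss_inner hr hs hsd (h.closed _ (by omega) (Or.inl (by omega)))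
  have hroot : ∀ r, r ≤ m → ∀ y, j + r * d < y → y < j + d + m * d → SLt f (j + r * d) y := by
    intro r hr y hy hy'
    obtain ⟨r', s, rfl, hs, hr'⟩ := exists_block hd (x := y) (m := m) (by omega) hy'
    have hrr : r ≤ r' := by
      by_contra hlt
      have : (r' + 1) * d ≤ r * d := Nat.mul_le_mul_right d (by omega)
      rw [Nat.succ_mul] at this; omega
    rcases Nat.eq_zero_or_pos s with rfl | hs0
    · rcases hrr.lt_or_eq with h4 | rfl
      · exact H.sLt_later hlt h4 (by omega)
      · omega
    · have h5 := H.sLt_inner hr' hs0 hs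
      rcases hrr.lt_or_eq with h4 | rfl
      · exact (H.sLt_later hlt h4 (by omega)).trans h5
      · exact h5
  have hinner : ∀ r s, r < m → 0 < s → s < d →
      ∃ y, j + r * d + s < y ∧ y < j + d + m * d ∧ SLt f y (j + r * d + s) := by
    intro r s hr hs hsd
    have : (r + 1) * d ≤ m * d := Nat.mul_le_mul_right d hr
    refine ⟨j + (r + 1) * d, ?_, by omega, H.next_sLt_inner hr.le hs hsd⟩
    rw [Nat.succ_mul]; omega
  refine ⟨by omega, by omega, ?_, ?_, ?_, ?_⟩
  · intro z hz y hy1 hy2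
    obtain rfl : z = j + m * d := by omega
    exact hroot m le_rfl y hy1 hy2
  · intro x hx1 hx2
    obtain ⟨s, rfl⟩ : ∃ s, x = j + m * d + s := ⟨x - (j + m * d), by omega⟩
    have := H.next_sLt_inner le_rfl (s := s) (by omega) (by omega)
    rwa [show j + (m + 1) * d = j + d + m * d by ring] at this
  · intro x hx1 hx2
    rcases Nat.lt_or_ge x (j + 1) with h4 | h4
    · rw [h1 x (by omega)]
      exact h.opened x h4 fun y h5 h6 => hx2 y h5 (by omega)
    · obtain ⟨r, s, rfl, hs, hr⟩ := exists_block hd (x := x) (j := j) (m := m) (by omega) (by omega)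
      rcases Nat.eq_zero_or_pos s with rfl | hs0
      · have hr0 : 1 ≤ r := by
          by_contra h0
          obtain rfl : r = 0 := by omega
          omega
        rw [periodic_copy hd h2 h3 r 0 hd hr0 hr, if_pos rfl]
        obtain ⟨q, rfl⟩ : ∃ q, r = q + 1 := ⟨r - 1, by omega⟩
        have e : (q + 1) * d = q * d + d := by ring
        have := H.prevEnd_root hlt (r := q) (by omega)
        rw [Nat.add_zero (j + (q + 1) * d), this]; omega
      · have hrm : r < m := by
          rcases hr.lt_or_eq with h5 | rfl
          · exact h5
          · omega
        obtain ⟨y, k1, k2, k3⟩ := hinner r s hrm hs0 hs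
        exact absurd k3 (hx2 y k1 k2).asymm
  · intro x hx1 hx2
    rcases Nat.lt_or_ge x (j + 1) with h4 | h4
    · obtain ⟨y, k1, k2, k3⟩ := hx2.resolve_left (by omega)
      rw [h1 x (by omega)]
      refine h.closed x (by omega) (Or.inr ?_)
      rcases Nat.lt_or_ge y (j + 1) with h5 | h5
      · exact ⟨y, k1, by omega, k3⟩
      · rcases Nat.lt_or_ge x j with h6 | h6
        · refine ⟨j, h6, by omega, ?_⟩
          have h7 := hroot 0 (by omega) y (by omega) k2
          simp only [Nat.zero_mul, Nat.add_zero] at h7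
          exact h7.trans k3
        · obtain rfl : x = j := by omega
          have h7 := hroot 0 (by omega) y (by omega) k2
          simp only [Nat.zero_mul, Nat.add_zero] at h7
          exact absurd k3 h7.asymm
    · obtain ⟨r, s, rfl, hs, hr⟩ := exists_block hd (x := x) (j := j) (m := m) (by omega) (by omega)
      rcases Nat.eq_zero_or_pos s with rfl | hs0
      · exfalso
        have := Nat.mul_le_mul_right d hr
        obtain ⟨y, k1, k2, k3⟩ := hx2.resolve_left (by omega)
        exact (hroot r hr y (by omega) k2).asymm k3
      · exact hclosed r s hr hs0 hs

/-- A decreasing run: each repetition of the Lyndon word closes the one before. The suffixes on the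
stack stay smaller, because they differ from the run within the first repetition. -/
theorem Scan.run_dec (hf : Padded f n) (h : Scan f n (j + d) t A) (H : Run f j d l m)
    (htj : t ≤ j) (ht : ∀ z, z + 1 = t → SLt f z (j + d))
    (hlt : f (j + d + l) < f (j + l)) (hm : 1 ≤ m) (hn : j + d + l ≤ n)
    (h1 : ∀ x < j + d, A' x = A x) (h2 : A' (j + d) = d)
    (h3 : ∀ x, j + d < x → x < j + d + m * d → A' x = A' (x - d)) :
    Scan f n (j + d + m * d) t A' := by
  have hd := H.pos
  have hl := H.le
  rw [Nat.succ_mul] at hl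
  have hmd : d ≤ m * d := Nat.le_mul_of_pos_left d hm
  have hdec : SLt f (j + d) j := ⟨l, H.agree.symm, hlt⟩
  have hlast : ∀ r s, r ≤ m → s < d → SLt f (j + d + m * d) (j + r * d + s) := by
    intro r s hr hs
    have e : j + d + m * d = j + (m + 1) * d := by ring
    rw [e]
    rcases Nat.eq_zero_or_pos s with rfl | hs0
    · exact H.later_sLt hdec (by omega) le_rfl
    · have h4 := H.next_sLt_inner hr hs0 hs
      rcases (Nat.succ_le_succ hr).lt_or_eq with h5 | h5
      · exact (H.later_sLt hdec h5 le_rfl).trans h4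
      · rw [← Nat.succ_injective h5]; exact h4
  have hbelow : ∀ z, z + 1 = t → ∀ y, z < y → y < j + d + m * d → SLt f z y := by
    intro z hz y hy1 hy2
    rcases Nat.lt_or_ge y (j + d) with h4 | h4
    · exact h.top z hz y hy1 h4
    · have hzd : SLt f z (z + d) := h.top z hz _ (by omega) (by omega)
      have hno : ¬ Agree f z (j + d) d := by
        intro h5
        obtain ⟨g, k1, k2⟩ := ht z hz
        have hg : d ≤ g := by
          by_contra h6
          exact k2.ne (h5 g (by omega))
        rcases lt_trichotomy g l with h6 | rfl | h6
        · refine hzd.asymm (sLt_of_break H.agree hd h6.le hg k1 ?_)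
          rw [H.agree g h6]; exact k2
        · exact hzd.asymm (sLt_of_break H.agree hd le_rfl hg k1 (k2.trans hlt))
        · refine hzd.asymm (sLt_of_break H.agree hd le_rfl (by omega) (k1.mono h6.le) ?_)
          rw [k1 l h6]; exact hlt
      obtain ⟨r, s, rfl, hs, hr⟩ := exists_block hd (x := y) (j := j) (m := m) (by omega) (by omega)
      have h7 : SLt f z (j + r * d) := by
        refine (SLt.transfer (m := d) (fun _ _ => rfl) ?_ hno).1 (ht z hz)
        exact (H.agree.symm.mono (by omega)).trans ((H.agree_block hr).mono (by omega))
      rcases Nat.eq_zero_or_pos s with rfl | hs0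
      · exact h7
      · exact h7.trans (H.sLt_inner hr hs0 hs)
  refine ⟨by omega, by omega, hbelow, ?_, ?_, ?_⟩
  · intro x hx1 hx2
    rcases Nat.lt_or_ge x j with h4 | h4
    · have := hlast 1 0 hm hd
      simp only [Nat.one_mul, Nat.add_zero] at this
      exact this.trans (h.gap x hx1 (by omega))
    · obtain ⟨r, s, rfl, hs, hr⟩ := exists_block hd (x := x) (j := j) (m := m) h4 hx2
      exact hlast r s hr hs
  · intro x hx1 hx2
    rw [h1 x (by omega)]
    exact h.opened x hx1 fun y h5 h6 => hx2 y h5 (by omega)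
  · intro x hx1 hx2
    rcases Nat.lt_or_ge x (j + d) with h4 | h4
    · rw [h1 x h4]
      refine h.closed x h4 ?_
      by_contra hno
      push Not at hno
      obtain ⟨k1, k2⟩ := hno
      obtain ⟨y, k3, k4, k5⟩ := hx2.resolve_left (by omega)
      have hz := hbelow (t - 1) (by omega)
      rcases eq_or_ne x (t - 1) with rfl | h6
      · exact (hz y k3 k4).asymm k5
      · have h7 : SLt f x (t - 1) :=
          (hf.not_sLt (by omega) (by omega) (by omega)).1 (k2 (t - 1) (by omega) (by omega))
        rcases Nat.lt_or_ge y (j + d) with h8 | h8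
        · exact k2 y k3 h8 k5
        · exact (h7.trans (hz y (by omega) k4)).asymm k5
    · obtain ⟨r, s, rfl, hs, hr⟩ := exists_block hd (x := x) (j := j) (m := m) (by omega) hx1
      have hr0 : 1 ≤ r := by
        by_contra h0
        obtain rfl : r = 0 := by omega
        omega
      rw [periodic_copy hd h2 h3 r s hs hr0 hr]
      split_ifs with hs0
      · subst hs0
        refine ⟨by omega, ?_, ?_⟩
        · have := H.later_sLt hdec (r := r) (r' := r + 1) (by omega) (by omega)
          rwa [show j + (r + 1) * d = j + r * d + 0 + d by ring] at this
        · intro z hz1 hz2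
          obtain ⟨s, rfl⟩ : ∃ s, z = j + r * d + s := ⟨z - (j + r * d), by omega⟩
          exact H.sLt_inner hr (by omega) (by omega)
      · rw [h1 _ (by omega)]
        exact H.isNss_inner hr (by omega) hs (h.closed _ (by omega) (Or.inl (by omega)))

end Repetitions

/-! ### Smaller suffixes in a copy of a word -/

/-- In the part of the string from `x` on that ends before `e`, the period `p` may be used several
times. -/
theorem period_mul {β : Type*} {f : ℕ → β} {x e p : ℕ}
    (h : ∀ y, x ≤ y → y + p < e → f y = f (y + p)) {y k : ℕ}
    (hy : x ≤ y) (hk : y + k * p < e) : f y = f (y + k * p) := by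
  induction k with
  | zero => simp
  | succ k ih =>
    rw [Nat.succ_mul] at hk ⊢
    rw [ih (by omega), ← Nat.add_assoc]
    exact h _ (by omega) (by omega)

section Window

variable {γ : Type*} [LinearOrder γ] {f : ℕ → WithBot γ} {n : ℕ}

/-- The word of length `L` at `i` is a copy of the one at `j`, where the next smaller suffixes are
known, and no comparison along a Lyndon word that starts and ends among the first `Y` positions
needs symbols beyond the copy. -/
structure Window (f : ℕ → WithBot γ) (n i j L Y : ℕ) (A : ℕ → ℕ) : Prop where
  lt : j < i
  le : j + L ≤ i
  i_le : i + L ≤ n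
  lyn : Lyn f j i
  agree : Agree f j i L
  closed : ∀ x, 0 < x → x < Y → IsNss f (j + x) (j + x + A (j + x))
  Y_le : Y ≤ L
  inside : ∀ x y, x < y → y < Y → Lyn f (j + x) (j + y) → ¬ Agree f (j + x) (j + y) (L - y)

namespace Window

variable {i j L Y : ℕ} {A A' : ℕ → ℕ} (H : Window f n i j L Y A)
include H

/-- If no suffix between `x` and `y` is smaller than that at `x`, then the suffixes at `x` and `y`
compare in the copy as in the original. If the word from `x` to `y` is a Lyndon word, the comparison
ends within the copy; otherwise `x` is compared with the previous smaller suffix of `y`, which is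
compared with `y`. -/
theorem transfer (hf : Padded f n) {x y : ℕ} (hxy : x < y) (hY : y < Y)
    (hz : ∀ z, x < z → z < y → SLt f (j + x) (j + z)) :
    (SLt f (j + x) (j + y) → SLt f (i + x) (i + y)) ∧
      (SLt f (j + y) (j + x) → SLt f (i + y) (i + x)) := by
  induction hk : y - x using Nat.strong_induction_on generalizing x y with
  | _ k ih =>
    have hle := H.le
    have hil := H.i_le
    have hYL := H.Y_le
    by_cases hy : ∀ z, x < z → z < y → SLt f (j + y) (j + z)
    · have h1 : Lyn f (j + x) (j + y) := by
        refine lyn_of_sLt (fun z h1 h2 => ?_) (fun z h1 h2 => ?_)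
        · obtain ⟨w, rfl⟩ : ∃ w, z = j + w := ⟨z - j, by omega⟩
          exact hz w (by omega) (by omega)
        · obtain ⟨w, rfl⟩ : ∃ w, z = j + w := ⟨z - j, by omega⟩
          exact hy w (by omega) (by omega)
      have h2 := H.inside x y hxy hY h1
      have h3 : Agree f (j + x) (i + x) (L - y) := (H.agree.shift (by omega)).mono (by omega)
      have h4 : Agree f (j + y) (i + y) (L - y) := H.agree.shift (by omega)
      exact ⟨(SLt.transfer h3 h4 h2).1, (SLt.transfer h4 h3 fun h => h2 h.symm).1⟩
    · push Not at hy
      obtain ⟨z, h1, h2, h3⟩ := hy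
      have h3' : SLt f (j + z) (j + y) := (hf.not_sLt (by omega) (by omega) (by omega)).1 h3
      have h4 : j + z < prevEnd f (j + y) := by
        by_contra h5
        exact not_sLt_of_prevEnd_le (by omega) (by omega) h3'
      have h5 := prevEnd_le (f := f) (j + y)
      obtain ⟨q, hq⟩ : ∃ q, j + q + 1 = prevEnd f (j + y) :=
        ⟨prevEnd f (j + y) - 1 - j, by omega⟩
      have h6 := sLt_of_prevEnd hq
      have h7 : ∀ w, q < w → w < y → SLt f (j + q) (j + w) := fun w k1 k2 =>
        h6.trans ((hf.not_sLt (by omega) (by omega) (by omega)).1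
          (not_sLt_of_prevEnd_le (by omega) (by omega)))
      have h8 := hz q (by omega) (by omega)
      refine ⟨fun _ => ?_, fun h => absurd h (h8.trans h6).asymm⟩
      have k1 := (ih (y - q) (by omega) (x := q) (y := y) (by omega) hY h7 rfl).1 h6
      have k2 := (ih (q - x) (by omega) (x := x) (y := q) (by omega) (by omega)
        (fun w k1 k2 => hz w k1 (by omega)) rfl).1 h8
      exact k2.trans k1

/-- A next smaller suffix among the copied positions is copied. -/
theorem closed_copy (hf : Padded f n) {x : ℕ} (hx : 0 < x) (hx' : x < Y)
    (h : x + A (j + x) < Y) : IsNss f (i + x) (i + x + A (j + x)) := by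
  have h1 := H.closed x hx hx'
  have h2 := h1.lt
  refine ⟨by omega, ?_, fun z h3 h4 => ?_⟩
  · rw [Nat.add_assoc]
    refine (H.transfer hf (x := x) (y := x + A (j + x)) (by omega) h fun z h3 h4 =>
      h1.between _ (by omega) (by omega)).2 ?_
    rw [← Nat.add_assoc]; exact h1.sLt
  · obtain ⟨z, rfl⟩ : ∃ w, z = i + w := ⟨z - i, by omega⟩
    exact (H.transfer hf (x := x) (y := z) (by omega) (by omega) fun w h5 h6 =>
      h1.between _ (by omega) (by omega)).1 (h1.between _ (by omega) (by omega))

/-- Positions with their next smaller suffix behind the copied positions are on the stack after the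
copying. -/
theorem open_copy (hf : Padded f n) {x : ℕ} (hx : x < Y) (h : x = 0 ∨ Y ≤ x + A (j + x)) {y : ℕ}
    (hxy : x < y) (hy : y < Y) : SLt f (i + x) (i + y) := by
  have hYL := H.Y_le
  have hle := H.le
  have key : ∀ z, x < z → z < Y → SLt f (j + x) (j + z) := by
    intro z h1 h2
    rcases Nat.eq_zero_or_pos x with rfl | h0
    · exact H.lyn.sLt (by omega) (by omega)
    · exact (H.closed x h0 hx).between _ (by omega) (by omega)
  exact (H.transfer hf hxy hy fun z h1 h2 => key z h1 (by omega)).1 (key y hxy hy)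

/-- The previous smaller suffix of an element of the stack in the copy is the previous element of
the stack. -/
theorem prevEnd_copy (hf : Padded f n) {o x : ℕ} (hox : o < x) (hx : x < Y)
    (ho : o = 0 ∨ Y ≤ o + A (j + o)) (hx' : Y ≤ x + A (j + x))
    (hbetween : ∀ z, o < z → z < x → z + A (j + z) < Y) : prevEnd f (i + x) = i + o + 1 := by
  have key : ∀ z, o < z → z < x → SLt f (i + x) (i + z) := by
    intro z
    induction hk : x - z using Nat.strong_induction_on generalizing z with
    | _ k ih =>
      intro h1 h2
      have h3 := hbetween z h1 h2
      have h4 := H.closed z (by omega) (by omega)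
      have h5 := h4.lt
      have h6 := H.closed_copy hf (by omega) (by omega) h3
      rcases lt_trichotomy (z + A (j + z)) x with h7 | h7 | h7
      · have h8 := ih (x - (z + A (j + z))) (by omega) _ rfl (by omega) h7
        rw [← Nat.add_assoc] at h8
        exact h8.trans h6.sLt
      · rw [← h7, ← Nat.add_assoc]; exact h6.sLt
      · exfalso
        have h8 := h4.between (j + x) (by omega) (by omega)
        have h9 := (H.closed x (by omega) hx).le_of_sLt (z := j + z + A (j + z)) (by omega)
          (h4.sLt.trans h8)
        omega
  refine prevEnd_eq (by omega) ?_ ?_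
  · intro z hz
    obtain rfl : z = i + o := by omega
    exact H.open_copy hf (by omega) ho hox hx
  · intro z h1 h2
    obtain ⟨w, rfl⟩ : ∃ w, z = i + w := ⟨z - i, by omega⟩
    exact (key w (by omega) (by omega)).asymm

/-- The state of the scan after the entries have been copied, where the elements of the stack are
linked anew. -/
theorem scan (hf : Padded f n) (h : Scan f n (i + 1) (i + 1) A) (hY : 0 < Y)
    (h1 : ∀ x ≤ i, A' x = A x)
    (h2 : ∀ x, 0 < x → x < Y → x + A (j + x) < Y → A' (i + x) = A (j + x))
    (h3 : ∀ x, 0 < x → x < Y → Y ≤ x + A (j + x) → A' (i + x) = i + x + 1 - prevEnd f (i + x)) :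
    Scan f n (i + Y) (i + Y) A' := by
  have hYL := H.Y_le
  have hil := H.i_le
  refine ⟨le_rfl, by omega, by omega, by omega, ?_, ?_⟩
  · intro x k1 k2
    rcases Nat.lt_or_ge i x with k3 | k3
    · obtain ⟨s, rfl⟩ : ∃ s, x = i + s := ⟨x - i, by omega⟩
      refine h3 s (by omega) (by omega) ?_
      by_contra k4
      have k5 := H.closed_copy hf (x := s) (by omega) (by omega) (by omega)
      exact (k2 _ k5.lt (by omega)).asymm k5.sLt
    · rw [h1 x k3]
      exact h.opened x (by omega) fun y k4 k5 => k2 y k4 (by omega)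
  · intro x k1 k2
    obtain ⟨y, k4, k5, k6⟩ := k2.resolve_left (by omega)
    rcases Nat.lt_or_ge i x with k3 | k3
    · obtain ⟨s, rfl⟩ : ∃ s, x = i + s := ⟨x - i, by omega⟩
      by_cases k7 : s + A (j + s) < Y
      · rw [h2 s (by omega) (by omega) k7]
        exact H.closed_copy hf (by omega) (by omega) k7
      · exfalso
        obtain ⟨y, rfl⟩ : ∃ w, y = i + w := ⟨y - i, by omega⟩
        exact (H.open_copy hf (x := s) (y := y) (by omega) (Or.inr (by omega)) (by omega)
          (by omega)).asymm k6
    · rw [h1 x k3]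
      refine h.closed x (by omega) (Or.inr ?_)
      rcases Nat.lt_or_ge i y with k7 | k7
      · obtain ⟨y, rfl⟩ : ∃ w, y = i + w := ⟨y - i, by omega⟩
        have k8 : SLt f i (i + y) :=
          H.open_copy hf (x := 0) (y := y) (by omega) (Or.inl rfl) (by omega) (by omega)
        rcases k3.lt_or_eq with k9 | rfl
        · exact ⟨i, k9, by omega, k8.trans k6⟩
        · exact absurd k6 k8.asymm
      · exact ⟨y, k4, by omega, k6⟩

end Window

/-- The positions at which a repetition of a Lyndon word that covers the end of the word of length
`4 * r` at `j` may start. If the word from `x` on has period `y - x`, where the block between `x`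
and `y` is a Lyndon word, then the least suffix `c` that starts in the second quarter starts with
this block, and the next occurrence of the block is the least suffix `b` that follows within
distance `r` and not behind the next smaller suffix `v` of `c`. -/
theorem root_of_period {j r e c v b x y : ℕ} (he : j + 4 * r ≤ e)
    (hc : j + r ≤ c) (hc' : c < j + 2 * r)
    (hcmin : ∀ z, j + r ≤ z → z < j + 2 * r → z ≠ c → SLt f c z)
    (hv : IsNss f c v) (hbc : c < b) (hbv : b ≤ v) (hbr : b ≤ c + r)
    (hbmin : ∀ z, c < z → z ≤ v → z ≤ c + r → z ≠ b → SLt f b z)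
    (hx : j ≤ x) (hxy : x < y) (hy : y < j + r) (hl : Lyn f x y)
    (ha : Agree f x y (e - y)) :
    b = c + (y - x) ∧ ∃ k, c = x + k * (y - x) := by
  obtain ⟨p, rfl⟩ : ∃ p, y = x + p := ⟨y - x, by omega⟩
  have hp : 0 < p := by omega
  rw [show x + p - x = p by omega]
  have hper : ∀ q, x + q * p ≤ e → Agree f x (x + q * p) (e - x - q * p) := fun q hq => by
    have := agree_mul (l := e - (x + p)) ha q (by omega)
    rwa [show e - (x + p) + p - q * p = e - x - q * p by omega] at this
  have hblock : ∀ q, x + q * p + p ≤ e → Lyn f (x + q * p) (x + q * p + p) := fun q hq =>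
    hl.transfer (by omega) ((hper q (by omega)).mono (by omega))
  have hnext : ∀ q s, 0 < s → s < p → x + q * p + 2 * p ≤ e →
      SLt f (x + q * p) (x + q * p + s) ∧ SLt f (x + q * p + p) (x + q * p + s) := by
    intro q s hs hsp hq
    have h1 := hblock q (by omega)
    refine ⟨h1.sLt (by omega) (by omega), h1.sLt_of_agree (m := p) (by omega) (by omega) ?_
      (by omega)⟩
    have h2 := (hper (q + 1) (by rw [Nat.succ_mul]; omega)).mono (m' := p)
      (by rw [Nat.succ_mul]; omega)
    rw [Nat.succ_mul, ← Nat.add_assoc] at h2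
    exact ((hper q (by omega)).symm.mono (by omega)).trans h2
  obtain ⟨k, s, hks, hs⟩ : ∃ k s, c = x + k * p + s ∧ s < p := by
    refine ⟨(c - x) / p, (c - x) % p, ?_, Nat.mod_lt _ hp⟩
    have := Nat.mod_add_div (c - x) p
    rw [Nat.mul_comm] at this; omega
  have hs0 : s = 0 := by
    by_contra hs0
    obtain ⟨h1, h2⟩ := hnext k s (by omega) hs (by omega)
    rw [← hks] at h1 h2
    rcases Nat.lt_or_ge (x + k * p + p) (j + 2 * r) with h3 | h3
    · exact h2.asymm (hcmin _ (by omega) h3 (by omega))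
    · exact h1.asymm (hcmin _ (by omega) (by omega) (by omega))
  subst hs0
  rw [Nat.add_zero] at hks
  refine ⟨?_, k, hks⟩
  by_contra hb
  have hcv : c + p ≤ v := by
    by_contra h1
    have h2 := hv.lt
    have := (hnext k (v - c) (by omega) (by omega) (by omega)).1
    rw [← hks, show c + (v - c) = v by omega] at this
    exact this.asymm hv.sLt
  have h1 := hbmin (c + p) (by omega) hcv (by omega) (by omega)
  rcases Nat.lt_or_ge b (c + p) with h2 | h2
  · have h3 := (hnext k (b - c) (by omega) (by omega) (by omega)).2
    rw [← hks, show c + (b - c) = b by omega] at h3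
    exact h1.asymm h3
  · -- the block at `c` is followed by a larger suffix, and so are its repetitions
    have h3 : SLt f c (c + p) := hv.between _ (by omega) (by omega)
    obtain ⟨q, s, hqs, hs⟩ : ∃ q s, b = c + q * p + s ∧ s < p := by
      refine ⟨(b - c) / p, (b - c) % p, ?_, Nat.mod_lt _ hp⟩
      have := Nat.mod_add_div (b - c) p
      rw [Nat.mul_comm] at this; omega
    have hcag : Agree f c (c + p) (e - c - p) := by
      have e1 := hper k (by omega)
      have e2 := hper (k + 1) (by rw [Nat.succ_mul]; omega)
      rw [Nat.succ_mul, ← Nat.add_assoc, ← hks] at e2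
      rw [← hks] at e1
      exact (e1.symm.mono (by omega)).trans (e2.mono (by omega))
    have hinc : ∀ q, 1 ≤ q → q * p ≤ r → c + q * p ≠ c + p → SLt f (c + p) (c + q * p) := by
      intro q hq
      induction q, hq using Nat.le_induction with
      | base => intro _ h; simp at h
      | succ q hq ih =>
        intro h4 _
        rw [Nat.succ_mul] at h4 ⊢
        have h5 : SLt f (c + q * p) (c + (q * p + p)) := by
          rw [show c + (q * p + p) = c + p + q * p by ring]
          exact (SLt.shift (hcag.mono (by omega))).2 h3
        by_cases h6 : c + q * p = c + p
        · rw [h6] at h5; exact h5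
        · exact (ih (by omega) h6).trans h5
    have hq : 1 ≤ q := by
      by_contra h0
      obtain rfl : q = 0 := by omega
      omega
    have h4 : c + q * p ≠ c + p → SLt f (c + p) (c + q * p) := hinc q hq (by omega)
    have h5 : s ≠ 0 → SLt f (c + q * p) b := fun hs0 => by
      have h6 := hblock (k + q) (by rw [Nat.add_mul]; omega)
      rw [Nat.add_mul, ← Nat.add_assoc, ← hks] at h6
      exact h6.sLt (by omega) (by omega)
    refine h1.asymm ?_
    by_cases hs0 : s = 0
    · subst hs0
      rw [hqs, Nat.add_zero]
      exact h4 (by omega)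
    · by_cases h6 : c + q * p = c + p
      · rw [← h6]; exact h5 hs0
      · exact (h4 h6).trans (h5 hs0)

end Window

/-! ### Next smaller suffixes and the Lyndon array -/

section LyndonArray

variable {α : Type*}

theorem padded_padded (S : List α) : Padded (WordRAM.padded S) S.length := by
  intro x
  unfold WordRAM.padded
  split_ifs with h <;> simp <;> omega

variable [LinearOrder α]

/-- Two suffixes of the word that ends at `e`: the longer one is smaller if and only if the first
difference, which lies before `e`, is in its favour. -/
theorem take_drop_lt_iff {S : List α} {x y e : ℕ} (hx : x < y) (he : y ≤ e) (hn : e ≤ S.length) :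
    (S.drop x).take (e - x) < (S.drop y).take (e - y) ↔
      ∃ k, y + k < e ∧ Agree (WordRAM.padded S) x y k ∧
        WordRAM.padded S (x + k) < WordRAM.padded S (y + k) := by
  rw [List.lt_iff_exists]
  have hg : ∀ a k (h : k < ((S.drop a).take (e - a)).length),
      ((((S.drop a).take (e - a))[k] : α) : WithBot α) = WordRAM.padded S (a + k) := by
    intro a k h
    simp only [List.length_take, List.length_drop] at h
    unfold WordRAM.padded
    rw [dif_pos (by omega)]
    simp
  constructor
  · rintro (⟨_, h⟩ | ⟨k, h1, h2, h3, h4⟩)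
    · simp only [List.length_take, List.length_drop] at h; omega
    · have h5 := h1
      have h6 := h2
      simp only [List.length_take, List.length_drop] at h5 h6
      refine ⟨k, by omega, fun m hm => ?_, ?_⟩
      · rw [← hg x m (by omega), ← hg y m (by omega), h3 m hm]
      · rw [← hg x k h1, ← hg y k h2]; exact WithBot.coe_lt_coe.2 h4
  · rintro ⟨k, h1, h2, h3⟩
    have l1 : k < ((S.drop x).take (e - x)).length := by
      simp only [List.length_take, List.length_drop]; omega
    have l2 : k < ((S.drop y).take (e - y)).length := by
      simp only [List.length_take, List.length_drop]; omega
    refine Or.inr ⟨k, l1, l2, fun m hm => ?_, ?_⟩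
    · have := h2 m hm
      rw [← hg x m (by omega), ← hg y m (by omega)] at this
      exact WithBot.coe_injective this
    · rw [← hg x k l1, ← hg y k l2] at h3
      exact WithBot.coe_lt_coe.1 h3

theorem isLyndonWord_iff {S : List α} {x l : ℕ} (hl : 0 < l) (hn : x + l ≤ S.length) :
    IsLyndonWord ((S.drop x).take l) ↔ Lyn (WordRAM.padded S) x (x + l) := by
  have hlen : ((S.drop x).take l).length = l := by
    simp only [List.length_take, List.length_drop]; omega
  have hne : (S.drop x).take l ≠ [] := by
    intro h; rw [h] at hlen; simp at hlen; omega
  have hd : ∀ i, ((S.drop x).take l).drop i = (S.drop (x + i)).take (x + l - (x + i)) := by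
    intro i
    rw [List.drop_take, List.drop_drop]
    congr 1; omega
  unfold IsLyndonWord Lyn
  simp only [hlen, hd]
  constructor
  · rintro ⟨_, h⟩ y h1 h2
    have := h (y - x) (by omega) (by omega)
    rw [show x + (y - x) = y by omega] at this
    have h3 := (take_drop_lt_iff (x := x) (y := y) (e := x + l) h1 h2.le hn).1
    rw [show x + l - x = l by omega] at h3
    exact h3 this
  · intro h
    refine ⟨hne, fun i h1 h2 => ?_⟩
    have h3 := (take_drop_lt_iff (x := x) (y := x + i) (e := x + l) (by omega) (by omega) hn).2
    rw [show x + l - x = l by omega] at h3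
    exact h3 (h _ (by omega) (by omega))

/-- The longest Lyndon word that starts at a position ends at its next smaller suffix. -/
theorem isLyndonArray_of_isNss {S : List α} {lam : Fin S.length → ℕ}
    (h : ∀ x : Fin S.length, IsNss (WordRAM.padded S) x (x + lam x)) : IsLyndonArray S lam := by
  intro x
  have hf := padded_padded S
  have hx := h x
  have h0 := hx.lt
  have hx' := x.2
  have hle : (x : ℕ) + lam x ≤ S.length := hx.le_of_sLt hx' (hf.end_sLt hx')
  refine ⟨⟨hle, ?_⟩, ?_⟩
  · rw [isLyndonWord_iff (by omega) hle]
    intro y h1 h2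
    obtain ⟨k, h3, h4⟩ := hx.between y h1 h2
    refine ⟨k, ?_, h3, h4⟩
    by_contra hk
    -- otherwise the next smaller suffix would be a proper suffix of a larger one
    obtain ⟨u, hu⟩ : ∃ u, y + u = x + lam x := ⟨x + lam x - y, by omega⟩
    have h5 : SLt (WordRAM.padded S) (x + u) (y + u) :=
      (SLt.shift (h3.mono (by omega))).2 ⟨k, h3, h4⟩
    rw [hu] at h5
    exact (h5.trans hx.sLt).asymm (hx.between _ (by omega) (by omega))
  · rintro l ⟨h1, h2⟩
    by_contra h3
    rw [isLyndonWord_iff (by omega) h1] at h2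
    exact (h2.sLt (x := x + lam x) (by omega) (by omega)).asymm hx.sLt

end LyndonArray

/-! ### Comparison with the top of the stack -/

section Comparison

variable {γ : Type*} [LinearOrder γ] {f : ℕ → WithBot γ} {n : ℕ}

/-- A word that starts at `z` with a Lyndon word that ends at `i`, and goes on as at `i`, never
continues with a symbol smaller than its periodic continuation. -/
theorem LynPeriod.not_lt {i z l p : ℕ} (h : LynPeriod f i l p) (hl : p ≤ l) (hzi : z < i)
    (hz : ∀ y, z < y → y < i → SLt f z y) (hlyn : Lyn f z i) (ha : Agree f z i (l + 1)) :
    ¬ f (i + l) < f (i + l - p) := by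
  intro hlt
  have h0 := h.pos
  have h1 : SLt f (z + p) z := by
    refine ⟨l - p, fun k hk => ?_, ?_⟩
    · rw [Nat.add_assoc, ha (p + k) (by omega), ha k (by omega), h.per k hk, Nat.add_assoc]
    · rw [show z + p + (l - p) = z + l by omega, ha l (by omega), ha (l - p) (by omega),
        show i + (l - p) = i + l - p by omega]
      exact hlt
  rcases Nat.lt_or_ge (z + p) i with h2 | h2
  · exact h1.asymm (hz _ (by omega) h2)
  · obtain ⟨d, rfl⟩ : ∃ d, i = z + d := ⟨i - z, by omega⟩
    have h3 : Lyn f (z + d) (z + d + d) := hlyn.transfer (by omega) (ha.mono (by omega))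
    have h4 : d = p := h3.period_unique h.lyn (by omega) h0 (by omega) hl
      (((ha.mono (m' := l) (by omega)).shift (by omega))) h.per
    have := ha l (by omega)
    rw [show z + d + l - p = z + l by omega, this] at hlt
    exact lt_irrefl _ hlt

/-- The word at `y` starts with a Lyndon word that ends at `y + c`, where the word at `i` occurs.
The word at `i` occurs at `y` as well if and only if its Lyndon period is `c`. -/
theorem LynPeriod.agree_iff {i y l p c : ℕ} (h : LynPeriod f i l p) (hc : 0 < c) (hcl : c < l)
    (hlyn : Lyn f y (y + c)) (hz : Agree f (y + c) i l) (hy : Agree f y i c) :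
    Agree f y i l ↔ c = p := by
  constructor
  · intro ha
    have h1 : Lyn f i (i + c) := hlyn.transfer (by omega) (ha.mono (by omega))
    refine h1.period_unique h.lyn hc h.pos hcl.le (by have := h.le; omega) (fun k hk => ?_) h.per
    rw [← hz k (by omega), Nat.add_assoc, Nat.add_assoc, ha (c + k) (by omega)]
  · rintro rfl k hk
    rcases Nat.lt_or_ge k c with h1 | h1
    · exact hy k h1
    · have h2 := hz (k - c) (by omega)
      have h3 := h.per (k - c) (by omega)
      rw [show y + c + (k - c) = y + k by omega] at h2
      rw [show i + c + (k - c) = i + k by omega] at h3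
      rw [h2, h3]

end Comparison

namespace WordRAM

/-- Sequential composition. -/
def block : List (Prog 19) → Prog 19
  | [] => .instr .nop
  | [p] => p
  | p :: q :: l => .seq p (block (q :: l))

/-! Abbreviations for programs that consist of one instruction; `half r a` is `r := a / 2`. -/

def skip : Prog 19 := .instr .nop
def mov (r a : Fin 19) : Prog 19 := .instr (.mov r a)
def add (r a b : Fin 19) : Prog 19 := .instr (.bin .add r a b)
def sub (r a b : Fin 19) : Prog 19 := .instr (.bin .sub r a b)
def half (r a : Fin 19) : Prog 19 := .instr (.bin .shr r a rOne)
def load (r a : Fin 19) : Prog 19 := .instr (.load r a)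
def store (a b : Fin 19) : Prog 19 := .instr (.store a b)

/-- Extends the number `l` of common symbols of the suffixes at `z` and `i` to its maximum. -/
def extend : Prog 19 := block [
  add rA rI rL, add rB rZ rL, mov rE rOne,
  .while (.lt rZero rE)
    (.ite (.lt rA rN)
      (.ite (.symEq rA rB)
        (block [add rL rL rOne, add rA rA rOne, add rB rB rOne])
        (mov rE rZero))
      (mov rE rZero))]

/-- Updates the Lyndon period `p` of the word at `i` from length `m` to length `l`. -/
def updatePeriod : Prog 19 :=
  .while (.lt rM rL) (block [
    .ite (.lt rM rP) skip (block [
      add rA rI rM, sub rB rA rP,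
      .ite (.symEq rA rB) skip (add rP rM rOne)]),
    add rM rM rOne])

/-- Clears `g` unless the words of length `l` at `t - 1` and `i` agree. The first `min c l` symbols
are compared; if `c < l`, these symbols lead to the former top of the stack, where the word at `i`
is known to occur, so that the rest is decided by the Lyndon period of the word at `i`. -/
def checkNext : Prog 19 := block [
  sub rY rT rOne, mov rH rC,
  .ite (.lt rL rH) (mov rH rL) skip,
  mov rA rY, mov rB rI, add rX rY rH, mov rE rOne,
  .while (.lt rZero rE)
    (.ite (.lt rA rX)
      (.ite (.symEq rA rB)
        (block [add rA rA rOne, add rB rB rOne])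
        (mov rE rZero))
      (mov rE rZero)),
  .ite (.lt rA rX) (mov rG rZero)
    (.ite (.lt rC rL) (.ite (.eq rC rP) skip (mov rG rZero)) skip)]

variable {γ : Type*} [LinearOrder γ] {f : ℕ → WithBot γ} {n : ℕ} {Q : View → Prop}

theorem extend_wp (hf : Padded f n) (v : View) (hz : v.z < v.i) (hl : v.i + v.l ≤ n)
    (ha : Agree f v.z v.i v.l)
    (hQ : ∀ l' a' b' e' tm', v.l ≤ l' → v.i + l' ≤ n → Agree f v.z v.i l' →
      f (v.z + l') ≠ f (v.i + l') → tm' ≤ v.tm + 6 * (l' - v.l) + 9 →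
      Q { v with l := l', a := a', b := b', e := e', tm := tm' }) :
    extend.wp f n Q v := by
  simp only [extend, block, add, mov, Prog.wp, Instr.wp, Test.safe, Test.holds, View.get, View.set,
    View.tick]
  refine ⟨by decide, by omega, by decide, by omega, by decide, ?_⟩
  refine ⟨fun u => ∃ l' e' tm',
    u = { v with l := l', a := v.i + l', b := v.z + l', e := e', tm := tm' }
    ∧ v.l ≤ l' ∧ v.i + l' ≤ n ∧ Agree f v.z v.i l' ∧ (e' = 0 → f (v.z + l') ≠ f (v.i + l')) ∧
    tm' + 5 * e' ≤ v.tm + 6 * (l' - v.l) + 8 ∧ e' ≤ 1, fun u => (n + 1 - u.l) + u.e,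
    ⟨v.l, 1, _, rfl, le_rfl, hl, ha, by omega, by omega, by omega⟩, ?_⟩
  rintro _ ⟨l', e', tm', rfl, h1, h2, h3, h4, h5, h6⟩
  dsimp only
  refine ⟨trivial, fun he => ⟨trivial, fun h7 => ⟨by omega, fun h8 => ?_, fun h8 => ?_⟩,
    fun h7 => ?_⟩,
    fun he => ?_⟩
  · refine ⟨by decide, by omega, by decide, by omega, by decide, by omega, ?_, by omega⟩
    exact ⟨l' + 1, e', _, rfl, by omega, by omega, h3.succ h8.symm, by omega, by omega, h6⟩
  · refine ⟨by decide, ⟨l', 0, _, rfl, h1, h2, h3, fun _ h9 => h8 h9.symm, by omega, by omega⟩,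
      by omega⟩
  · refine ⟨by decide, ⟨l', 0, _, rfl, h1, h2, h3, fun _ h9 => ?_, by omega, by omega⟩,
      by omega⟩
    rw [(hf (v.i + l')).2 (by omega), hf] at h9
    omega
  · exact hQ _ _ _ _ _ h1 h2 h3 (h4 (by simp at he; omega)) (by omega)

/-- In Duval's algorithm, a symbol that is too small would end the periodic part. This does not
occur here, since the word occurs at the top `z` of the stack as well (`LynPeriod.not_lt`). -/
theorem updatePeriod_wp (v : View) (hz : v.z < v.i) (hl : v.i + v.l ≤ n)
    (ha : Agree f v.z v.i v.l) (hlyn : Lyn f v.z v.i)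
    (htop : ∀ y, v.z < y → y < v.i → SLt f v.z y) (hm : v.m ≤ v.l) (hp : LynPeriod f v.i v.m v.p)
    (hQ : ∀ p' a' b' tm', LynPeriod f v.i v.l p' → tm' ≤ v.tm + 7 * (v.l - v.m) + 1 →
      Q { v with m := v.l, p := p', a := a', b := b', tm := tm' }) :
    updatePeriod.wp f n Q v := by
  simp only [updatePeriod, block, skip, add, sub, Prog.wp, Instr.wp, Test.safe, Test.holds,
    View.get, View.set, View.tick]
  refine ⟨fun u => ∃ m' p' a' b' tm', u = { v with m := m', p := p', a := a', b := b', tm := tm' } ∧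
    m' ≤ v.l ∧ v.m ≤ m' ∧ LynPeriod f v.i m' p' ∧ tm' ≤ v.tm + 7 * (m' - v.m),
    fun u => v.l - u.m, ⟨_, _, _, _, _, rfl, hm, le_rfl, hp, by omega⟩, ?_⟩
  rintro _ ⟨m', p', a', b', tm', rfl, h1, h2, h3, h4⟩
  dsimp only
  refine ⟨trivial, fun hml => ⟨trivial, fun h5 => ?_, fun h5 => ?_⟩, fun hml => ?_⟩
  · exact ⟨by decide, by omega, ⟨_, _, _, _, _, rfl, by omega, by omega, h3.succ_of_lt h5,
      by omega⟩,
      by omega⟩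
  · refine ⟨by decide, by omega, by decide, by omega, ⟨by omega, by omega⟩, fun h6 => ?_,
      fun h6 => ?_⟩
    · exact ⟨by decide, by omega, ⟨_, _, _, _, _, rfl, by omega, by omega,
        h3.succ_of_eq (by omega) h6.symm, by omega⟩, by omega⟩
    · have h7 := h3.not_lt (by omega) hz htop hlyn (ha.mono (by omega))
      exact ⟨by decide, by omega, by decide, by omega, ⟨_, _, _, _, _, rfl, by omega, by omega,
        h3.succ_of_gt (by omega) (lt_of_le_of_ne (not_lt.1 h7) (Ne.symm h6)), by omega⟩, by omega⟩
  · obtain rfl : m' = v.l := by omega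
    exact hQ _ _ _ _ h3 (by omega)

/-- If the words agree, the time is bounded by the symbols that the former top of the stack shares
with the new one, which the potential pays for; otherwise the search ends. -/
theorem checkNext_wp (v : View) (y : ℕ) (hy : y + 1 = v.t) (hc : v.z = y + v.c)
    (hc0 : 0 < v.c) (hzi : v.z < v.i) (hl : v.i + v.l ≤ n) (ha : Agree f v.z v.i v.l)
    (hlyn : Lyn f y v.z) (hp : LynPeriod f v.i v.l v.p)
    (hQ : ∀ y' h' a' b' x' e' g' tm',
      (g' = v.g ∧ Agree f y v.i v.l ∧ tm' ≤ v.tm + 5 * min v.c v.l + 20 ∨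
        g' = 0 ∧ ¬ Agree f y v.i v.l ∧ tm' ≤ v.tm + 5 * v.l + 20) →
      Q { v with y := y', h := h', a := a', b := b', x := x', e := e', g := g', tm := tm' }) :
    checkNext.wp f n Q v := by
  -- the comparison loop and what follows it
  have loop : ∀ h' tm', h' = min v.c v.l → tm' ≤ v.tm + 4 →
      (block [mov rA rY, mov rB rI, add rX rY rH, mov rE rOne,
        .while (.lt rZero rE)
          (.ite (.lt rA rX)
            (.ite (.symEq rA rB)
              (block [add rA rA rOne, add rB rB rOne])
              (mov rE rZero))
            (mov rE rZero)),
        .ite (.lt rA rX) (mov rG rZero)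
          (.ite (.lt rC rL) (.ite (.eq rC rP) skip (mov rG rZero)) skip)]).wp f n Q
        { v with y := y, h := h', tm := tm' } := by
    intro h' tm' hh htm
    simp only [block, skip, add, mov, Prog.wp, Instr.wp, Test.safe, Test.holds,
      View.get, View.set, View.tick]
    refine ⟨by decide, by decide, by decide, by omega, by decide, ?_⟩
    refine ⟨fun u => ∃ k e' tm', u =
      { v with y := y, h := h', x := y + h', a := y + k, b := v.i + k, e := e', tm := tm' } ∧
      k ≤ h' ∧ Agree f y v.i k ∧
      (e' = 0 → k < h' → f (y + k) ≠ f (v.i + k)) ∧ tm' + 5 * e' ≤ v.tm + 5 * k + 13 ∧ e' ≤ 1,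
      fun u => (n + 1 - u.b) + u.e, ⟨0, 1, _, rfl, by omega, fun k hk => by omega, by omega,
        by omega, by omega⟩, ?_⟩
    rintro _ ⟨k, e', tm', rfl, h1, h2, h3, h4, h5⟩
    dsimp only
    refine ⟨trivial, fun he => ⟨trivial, fun h6 => ⟨⟨by omega, by omega⟩, fun h7 => ?_,
      fun h7 => ?_⟩,
      fun h6 => ?_⟩, fun he => ?_⟩
    · exact ⟨by decide, by omega, by decide, by omega, ⟨k + 1, _, _, rfl, by omega, h2.succ h7,
        by omega, by omega, by omega⟩, by omega⟩
    · exact ⟨by decide, ⟨k, _, _, rfl, by omega, h2, fun _ _ => h7, by omega, by omega⟩, by omega⟩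
    · exact ⟨by decide, ⟨k, _, _, rfl, by omega, h2, by omega, by omega, by omega⟩, by omega⟩
    · refine ⟨trivial, fun h6 => ⟨by decide, ?_⟩, fun h6 => ⟨trivial, fun h7 => ⟨trivial,
        fun h8 => ?_,
        fun h8 => ⟨by decide, ?_⟩⟩, fun h7 => ?_⟩⟩
      · refine hQ _ _ _ _ _ _ _ _ (Or.inr ⟨rfl, fun h7 => ?_, by omega⟩)
        exact h3 (by omega) (by omega) (h7 k (by omega))
      · refine hQ _ _ _ _ _ _ _ _ (Or.inl ⟨rfl, ?_, by omega⟩)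
        exact (hp.agree_iff hc0 h7 (hc ▸ hlyn) (hc ▸ ha) (h2.mono (by omega))).2 h8
      · refine hQ _ _ _ _ _ _ _ _ (Or.inr ⟨rfl, ?_, by omega⟩)
        exact fun h9 => h8
          ((hp.agree_iff hc0 h7 (hc ▸ hlyn) (hc ▸ ha) (h2.mono (by omega))).1 h9)
      · exact hQ _ _ _ _ _ _ _ _ (Or.inl ⟨rfl, h2.mono (by omega), by omega⟩)
  have e : v.t - 1 = y := by omega
  simp only [checkNext, block, skip, add, sub, mov, Prog.wp, Instr.wp, Test.safe, Test.holds,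
    View.get, View.set, View.tick, e] at loop ⊢
  refine ⟨by decide, by omega, by decide, trivial, fun h1 => ⟨by decide, ?_⟩, fun h1 => ?_⟩
  · exact loop _ _ (by omega) (by omega)
  · exact loop _ _ (by omega) (by omega)

end WordRAM

/-! ### The search for the previous smaller suffix -/

section Found

variable {γ : Type*} [LinearOrder γ] {f : ℕ → WithBot γ} {n : ℕ}

/-- The Lyndon word that starts at `j₀` is repeated at `i`, and this repetition covers at least `E`
symbols from `i` on, which is at least twice its period. -/
structure Repeats (f : ℕ → WithBot γ) (i j₀ E : ℕ) : Prop where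
  lt : j₀ < i
  lyn : Lyn f j₀ i
  agree : Agree f j₀ i E
  le : 2 * (i - j₀) ≤ E

theorem Repeats.sLt {i j₀ E x : ℕ} (h : Repeats f i j₀ E) (h1 : j₀ < x) (h2 : x < i) :
    SLt f i x := by
  have := h.le
  exact h.lyn.sLt_of_agree h1 h2 (m := i - x) (h.agree.mono (by omega)) (by omega)

theorem Repeats.not_agree {i j₀ E x m : ℕ} (h : Repeats f i j₀ E) (h1 : j₀ < x) (h2 : x < i)
    (hm : i - x ≤ m) : ¬ Agree f x i m := by
  have := h.le
  intro h3
  exact h.lyn.not_agree h1 h2 (m := i - x) (h.agree.mono (by omega)) (by omega)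
    (h3.mono hm).symm

/-- The suffix at `j`, which has `l` symbols in common with the one at `i`, has been removed from
the stack because of `i`. -/
structure Popped (f : ℕ → WithBot γ) (i t j d l : ℕ) : Prop where
  lt : j < i
  d_eq : d = i - j
  t_le : t ≤ j
  lyn : Lyn f j i
  agree : Agree f j i l
  gt : f (i + l) < f (j + l)

/-- Once the Lyndon word at `j` is repeated in the first `l` symbols at `i`, all suffixes on the
stack that share these `l` symbols are larger. -/
theorem Popped.gt_top {i z j d l : ℕ} {A : ℕ → ℕ} (hp : Popped f i (z + 1) j d l)
    (h : Scan f n i (z + 1) A) (hd : d ≤ l) (ha : Agree f z i l) : f (i + l) < f (z + l) := by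
  by_contra hlt
  have h1 := hp.lt
  have h2 := hp.d_eq
  have h3 := hp.t_le
  obtain rfl : i = j + d := by omega
  have h4 := sLt_of_break hp.agree (by omega) le_rfl hd ha ((not_lt.1 hlt).trans_lt hp.gt)
  exact h4.asymm (h.top z rfl _ (by omega) (by omega))

/-- The situation after the search for the previous smaller suffix of `i`. The suffix at `j` has the
most symbols in common with the one at `i`, namely `l`; it is either the previous smaller suffix of
`i`, or `i` is its next smaller suffix. Only if there is no suffix to compare with, `j` is
meaningless. -/
structure Found (f : ℕ → WithBot γ) (n i t j d l : ℕ) (A : ℕ → ℕ) : Prop where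
  scan : Scan f n i t A
  top_sLt : ∀ z, z + 1 = t → SLt f z i
  most : ∀ z, z + 1 = t → ¬ Agree f z i (l + 1)
  le : i + l ≤ n
  cand : (l = 0 ∧ d = 1) ∨ Popped f i t j d l ∨
    (t = j + 1 ∧ j < i ∧ d = i - j ∧ Lyn f j i ∧ Agree f j i l)

end Found

namespace WordRAM

/-- One comparison of the search: compares the suffix at the top `z` of the stack with the one at
`i`, and removes it from the stack if it is larger. The candidate `j` is replaced by `z` only if the
word from `j` to `i` is not repeated in the first `l` symbols: a repetition that has been found must
not be lost. -/
def findStep : Prog 19 := block [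
  sub rZ rT rOne, half rH rL,
  .ite (.lt rH rD) (block [mov rJ rZ, sub rD rI rZ]) skip,
  extend, updatePeriod,
  add rA rI rL, add rB rZ rL, mov rH rOne,
  .ite (.lt rA rN) (.ite (.symLt rB rA) (mov rH rZero) skip) skip,
  .ite (.lt rZero rH)
    (block [load rC rZ, sub rX rI rZ, store rZ rX, sub rT rT rC,
      .ite (.lt rZero rT) checkNext (mov rG rZero)])
    (mov rG rZero)]

/-- Removes all larger suffixes than the one at `i` from the stack. -/
def findPrev : Prog 19 := block [
  mov rL rZero, mov rP rOne, mov rM rZero, mov rD rOne, mov rG rZero,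
  .ite (.lt rZero rT) (mov rG rOne) skip,
  .while (.lt rZero rG) findStep]

variable {γ : Type*} [LinearOrder γ] {f : ℕ → WithBot γ} {n : ℕ} {Q : View → Prop}

/-- The invariant of the search that started in the state `v`. While it goes on, `l` symbols at the
top of the stack have already been compared. The time is bounded by the loss of potential and by a
multiple of `l`; any repetition that was known before the search is found again. -/
structure FindInv (f : ℕ → WithBot γ) (n : ℕ) (v u : View) : Prop where
  i_eq : u.i = v.i
  g_le : u.g ≤ 1
  m_eq : u.m = u.l
  period : LynPeriod f u.i u.l u.p
  scan : Scan f n u.i u.t u.A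
  le : u.i + u.l ≤ n
  going : u.g = 1 → (∀ z, z + 1 = u.t → Agree f z u.i u.l) ∧ 0 < u.t ∧
    (u.l / 2 < u.d ∨ Popped f u.i u.t u.j u.d u.l) ∧
    (∀ j₀ E, Repeats f u.i j₀ E → j₀ < v.t → j₀ < u.t ∨ 2 * u.d ≤ u.l ∧ E ≤ u.l) ∧
    u.tm + 50 * pot f u.t ≤ v.tm + 50 * pot f v.t + 13 * u.l + 10
  done : u.g = 0 → Found f n u.i u.t u.j u.d u.l u.A ∧
    (∀ j₀ E, Repeats f u.i j₀ E → j₀ < v.t → 2 * u.d ≤ u.l ∧ E ≤ u.l) ∧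
    u.tm + 50 * pot f u.t ≤ v.tm + 50 * pot f v.t + 18 * u.l + 70

/-- Each step of the search either removes an element from the stack or ends the search. -/
theorem findStep_wp (hf : Padded f n) (v u : View) (hi : u.i < n) (h : FindInv f n v u)
    (hg : u.g = 1) :
    findStep.wp f n (fun u' => FindInv f n v u' ∧ u'.t + u'.g < u.t + u.g) u.tick := by
  obtain ⟨hag, ht0, hcand, hrep, htm⟩ := h.going hg
  have hscan := h.scan
  have hper := h.period
  have hle := h.le
  have hm := h.m_eq
  have hvi := h.i_eq
  obtain ⟨z, hz⟩ : ∃ z, z + 1 = u.t := ⟨u.t - 1, by omega⟩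
  have hagz := hag z hz
  have hti := hscan.t_le
  rw [← hz] at hscan
  have hlynz := hscan.lyn_top
  have hArr := hscan.arr_top
  have hple := prevEnd_le (f := f) z
  have hpot := pot_succ (f := f) z
  rw [hz] at hpot
  -- the rest of the step, after the candidate `j` has been chosen
  have main : ∀ j d h' tm', tm' ≤ u.tm + 6 →
      ((j = z ∧ d = u.i - z ∧ u.l / 2 < u.d) ∨
        (j = u.j ∧ d = u.d ∧ 2 * d ≤ u.l ∧ Popped f u.i u.t j d u.l)) →
      (block [extend, updatePeriod,
        add rA rI rL, add rB rZ rL, mov rH rOne,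
        .ite (.lt rA rN) (.ite (.symLt rB rA) (mov rH rZero) skip) skip,
        .ite (.lt rZero rH)
          (block [load rC rZ, sub rX rI rZ, store rZ rX, sub rT rT rC,
            .ite (.lt rZero rT) checkNext (mov rG rZero)])
          (mov rG rZero)]).wp f n (fun u' => FindInv f n v u' ∧ u'.t + u'.g < u.t + u.g)
        { u with z := z, h := h', j := j, d := d, tm := tm' } := by
    intro j d h' tm' htm' hjd
    simp only [block, Prog.wp]
    refine extend_wp hf _ (by dsimp only; omega) hle hagz ?_
    intro l a b e tm1 hl1 hl2 hagl hex htm1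
    dsimp only at hl1 hl2 hagl hex htm1 ⊢
    refine updatePeriod_wp _ (by dsimp only; omega) (by dsimp only; omega) hagl hlynz
      (hscan.top z rfl) (by dsimp only; omega) (by dsimp only; rw [hm]; exact hper) ?_
    intro p a b tm2 hp htm2
    dsimp only at hp htm2 ⊢
    -- a recorded repetition is not changed by further comparisons
    have hkeep : 2 * d ≤ u.l → Popped f u.i u.t j d u.l → l = u.l ∧ f (u.i + l) < f (z + l) := by
      intro h1 h2
      rw [← hz] at h2
      have h3 := h2.gt_top hscan (by omega) hagz
      have h4 : l = u.l := by
        by_contra h4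
        exact h3.ne (hagl u.l (by omega)).symm
      exact ⟨h4, h4 ▸ h3⟩
    have hrep' : ∀ j₀ E, Repeats f u.i j₀ E → j₀ < v.t →
        (2 * d ≤ l ∧ E ≤ l) ∨ (j₀ < z ∧ l < u.i - z) := by
      intro j₀ E hR hj₀
      rcases hjd with ⟨h1, h2, h3⟩ | ⟨h1, h2, h3, h4⟩
      · rcases hrep j₀ E hR hj₀ with h5 | h5
        · rcases Nat.lt_or_ge j₀ z with h6 | h6
          · refine Or.inr ⟨h6, ?_⟩
            by_contra h7
            exact hR.not_agree h6 (by omega) (by omega) hagl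
          · obtain rfl : j₀ = z := by omega
            have h7 := hR.le
            have h8 : E ≤ l := by
              by_contra h8
              exact hex (hR.agree l (by omega))
            left; omega
        · omega
      · obtain ⟨h5, h6⟩ := hkeep h3 h4
        rcases hrep j₀ E hR hj₀ with h7 | h7
        · exfalso
          have k1 := h4.t_le
          have k2 := h4.d_eq
          exact hR.not_agree (x := j) (by omega) h4.lt (by omega) h4.agree
        · left; omega
    -- the outcome of the comparison
    have pop : ∀ h' tm', tm' ≤ u.tm + 13 * (l - u.l) + 24 → f (u.i + l) < f (z + l) →
        (block [load rC rZ, sub rX rI rZ, store rZ rX, sub rT rT rC,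
            .ite (.lt rZero rT) checkNext (mov rG rZero)]).wp f n
          (fun u' => FindInv f n v u' ∧ u'.t + u'.g < u.t + u.g)
          { u with z := z, h := h', j := j, d := d, l := l, m := l, p := p, a := u.i + l,
                   b := z + l, e := e, tm := tm' } := by
      intro h' tm' htm' hgt
      have hpop := hscan.pop hf ⟨l, hagl.symm, hgt⟩
      have hP : Popped f u.i (prevEnd f z) j d l := by
        rcases hjd with ⟨h1, h2, h3⟩ | ⟨h1, h2, h3, h4⟩
        · rw [h1]
          exact ⟨by omega, h2, by omega, hlynz, hagl, hgt⟩
        · obtain ⟨h5, h6⟩ := hkeep h3 h4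
          rw [h5]
          have h7 := h4.t_le
          exact ⟨h4.lt, h4.d_eq, by omega, h4.lyn, h4.agree, h4.gt⟩
      have hrep'' : ∀ j₀ E, Repeats f u.i j₀ E → j₀ < v.t →
          j₀ < prevEnd f z ∧ l < u.i - z ∨ 2 * d ≤ l ∧ E ≤ l := by
        intro j₀ E hR hj₀
        rcases hrep' j₀ E hR hj₀ with h1 | h1
        · exact Or.inr h1
        · refine Or.inl ⟨?_, h1.2⟩
          by_contra h2
          exact not_sLt_of_prevEnd_le (by omega) h1.1 (hR.lyn.sLt h1.1 (by omega))
      simp only [block, load, sub, store, mov, Prog.wp, Instr.wp, Test.safe, Test.holds, View.get,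
        View.set, View.tick]
      have e1 : u.t - u.A z = prevEnd f z := by omega
      refine ⟨by decide, by omega, by decide, by omega, by omega, by decide, by omega, trivial,
        fun h1 => ?_, fun h1 => ⟨by decide, ?_, by omega⟩⟩
      · rw [e1] at h1 ⊢
        obtain ⟨y, hy⟩ : ∃ y, y + 1 = prevEnd f z := ⟨prevEnd f z - 1, by omega⟩
        refine checkNext_wp _ y hy (by dsimp only; omega) (by dsimp only; omega)
          (by dsimp only; omega)
          hl2 hagl (lyn_of_prevEnd hf (z := z) (by omega) hy) hp ?_
        intro y' h'' a' b' x' e' g' tm3 hcase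
        dsimp only at hcase ⊢
        rcases hcase with ⟨hg', hay, htm3⟩ | ⟨hg', hay, htm3⟩
        · have hov : min (u.A z) l ≤ overlap f z := le_overlap hy (by omega)
            ((hay.trans hagl.symm).mono (by omega))
          refine ⟨⟨hvi, by dsimp only; omega, rfl, hp, hpop, hl2, fun _ => ⟨?_, h1, Or.inr hP, ?_,
            ?_⟩,
            fun h2 => ?_⟩, by omega⟩
          · intro w hw
            dsimp only at hw ⊢
            obtain rfl : w = y := by omega
            exact hay
          · intro j₀ E hR hj₀
            exact (hrep'' j₀ E hR hj₀).imp (fun h => h.1) id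
          · dsimp only; omega
          · dsimp only at h2; omega
        · refine ⟨⟨hvi, by dsimp only; omega, rfl, hp, hpop, hl2, fun h2 => ?_,
            fun _ => ⟨⟨hpop, ?_, ?_, hl2, Or.inr (Or.inl hP)⟩, ?_, ?_⟩⟩, by omega⟩
          · dsimp only at h2; omega
          · intro w hw
            dsimp only at hw ⊢
            obtain rfl : w = y := by omega
            exact (SLt.transfer (fun _ _ => rfl) hagl fun h2 => hay (h2.trans hagl)).1
              (sLt_of_prevEnd hy)
          · intro w hw
            dsimp only at hw ⊢
            obtain rfl : w = y := by omega
            exact fun h2 => hay (h2.mono (by omega))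
          · intro j₀ E hR hj₀
            rcases hrep'' j₀ E hR hj₀ with h2 | h2
            · exfalso
              have hRle : 2 * (u.i - j₀) ≤ E := hR.le
              have hRlt : j₀ < u.i := hR.lt
              rcases Nat.lt_or_ge j₀ y with h3 | h3
              · have h4 : SLt f y u.i :=
                  (SLt.transfer (fun _ _ => rfl) hagl fun h2 => hay (h2.trans hagl)).1
                    (sLt_of_prevEnd hy)
                exact (hR.sLt (x := y) h3 (by dsimp only; omega)).asymm h4
              · obtain rfl : j₀ = y := by omega
                exact hay (hR.agree.mono (by omega))
            · exact h2
          · dsimp only; omega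
      · rw [e1] at h1
        refine ⟨hvi, by dsimp only; omega, rfl, hp, ?_, hl2, fun h2 => ?_,
          fun _ => ⟨⟨?_, ?_, ?_, hl2, Or.inr (Or.inl ?_)⟩, ?_, ?_⟩⟩
        · dsimp only; rw [e1]; exact hpop
        · dsimp only at h2; omega
        · dsimp only; rw [e1]; exact hpop
        · dsimp only; omega
        · dsimp only; omega
        · dsimp only; rw [e1]; exact hP
        · intro j₀ E hR hj₀
          rcases hrep'' j₀ E hR hj₀ with h2 | h2
          · omega
          · exact h2
        · dsimp only; rw [e1]; omega
    simp only [block, load, add, sub, store, mov, skip, Prog.wp, Instr.wp, Test.safe, Test.holds,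
      View.get, View.set, View.tick] at pop ⊢
    have last : f (u.i + l) < f (z + l) ∨ u.i + l < n ∧ f (z + l) < f (u.i + l) := by
      rcases lt_or_gt_of_ne hex with h1 | h1
      · refine Or.inr ⟨?_, h1⟩
        by_contra h2
        rw [(hf (u.i + l)).2 (by omega)] at h1
        exact not_lt_bot h1
      · exact Or.inl h1
    refine ⟨by decide, by omega, by decide, by omega, by decide, trivial, fun h1 =>
      ⟨⟨by omega, h1⟩, fun h2 => ⟨by decide, trivial, fun h3 => absurd h3 (by omega), fun _ =>
        ⟨by decide, ?_, by omega⟩⟩, fun h2 => ⟨trivial, fun _ => ?_,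
        fun h3 => absurd h3 (by omega)⟩⟩,
      fun h1 => ⟨trivial, fun _ => ?_, fun h3 => absurd h3 (by omega)⟩⟩
    · have hnew : j = z ∧ d = u.i - z ∧ u.l / 2 < u.d := by
        rcases hjd with h3 | ⟨_, _, h3, h4⟩
        · exact h3
        · exact absurd h2 (hkeep h3 h4).2.asymm
      have hzi : SLt f z u.i := ⟨l, hagl, h2⟩
      refine ⟨hvi, by dsimp only; omega, rfl, hp, h.scan, hl2, fun h3 => ?_,
        fun _ => ⟨⟨h.scan, ?_, ?_, hl2, Or.inr (Or.inr ?_)⟩, ?_, ?_⟩⟩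
      · dsimp only at h3; omega
      · intro w hw
        dsimp only at hw ⊢
        obtain rfl : w = z := by omega
        exact hzi
      · intro w hw
        dsimp only at hw ⊢
        obtain rfl : w = z := by omega
        exact fun h3 => hex (h3 l (by omega))
      · dsimp only
        rw [hnew.1]
        exact ⟨hz.symm, by omega, hnew.2.1, hlynz, hagl⟩
      · intro j₀ E hR hj₀
        rcases hrep' j₀ E hR hj₀ with h3 | h3
        · exact h3
        · exact absurd hzi (hR.sLt (x := z) h3.1 (by dsimp only; omega)).asymm
      · dsimp only; omega
    · exact pop _ _ (by omega) (last.resolve_right fun h3 => h2 h3.2)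
    · exact pop _ _ (by omega) (last.resolve_right fun h3 => h1 h3.1)
  have e : u.t - 1 = z := by omega
  have e2 : u.l / 2 ^ 1 = u.l / 2 := by rw [pow_one]
  simp only [findStep, block, half, sub, mov, skip, Prog.wp, Instr.wp, Test.safe, Test.holds,
    View.get, View.set, View.tick, e, e2] at main ⊢
  refine ⟨by decide, by omega, by decide, trivial, fun h1 => ⟨by decide, by decide, by omega, ?_⟩,
    fun h1 => ?_⟩
  · exact main z (u.i - z) _ _ (by omega) (Or.inl ⟨rfl, rfl, h1⟩)
  · exact main u.j u.d _ _ (by omega)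
      (Or.inr ⟨rfl, rfl, by omega, hcand.resolve_left h1⟩)

/-- The search takes time proportional to `l`, apart from the time that the elements that are
removed from the stack pay for. -/
theorem findPrev_wp (hf : Padded f n) (v : View) (hi : v.i < n) (h : Scan f n v.i v.t v.A)
    (hQ : ∀ u, u.i = v.i → Found f n u.i u.t u.j u.d u.l u.A →
      (∀ j₀ E, Repeats f u.i j₀ E → j₀ < v.t → 2 * u.d ≤ u.l ∧ E ≤ u.l) →
      u.tm + 50 * pot f u.t ≤ v.tm + 50 * pot f v.t + 18 * u.l + 71 → Q u) :
    findPrev.wp f n Q v := by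
  simp only [findPrev, block, mov, skip, Prog.wp, Instr.wp, Test.safe, Test.holds, View.get,
    View.set, View.tick]
  have loop : ∀ u, FindInv f n v u → True ∧ (0 < u.g → findStep.wp f n (fun u' => FindInv f n v u' ∧
      u'.t + u'.g < u.t + u.g) u.tick) ∧ (¬ 0 < u.g → Q u.tick) := by
    intro u hu
    have h1 := hu.g_le
    refine ⟨trivial,
      fun h2 => findStep_wp hf v u (by rw [hu.i_eq]; exact hi) hu (by omega), fun h2 => ?_⟩
    obtain ⟨k1, k2, k3⟩ := hu.done (by omega)
    exact hQ _ hu.i_eq k1 k2 (by simp only [View.tick]; omega)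
  refine ⟨by decide, by decide, by decide, by decide, by decide, trivial, fun h1 => ⟨by decide,
    FindInv f n v, fun u => u.t + u.g, ?_, loop⟩,
    fun h1 => ⟨FindInv f n v, fun u => u.t + u.g, ?_, loop⟩⟩
  · refine ⟨rfl, le_rfl, rfl, LynPeriod.init _, h, hi.le, fun _ => ⟨?_, h1, Or.inl ?_, ?_, ?_⟩, ?_⟩
    · exact fun z _ k hk => absurd hk (by simp)
    · simp
    · exact fun j₀ E _ h2 => Or.inl h2
    · dsimp only; omega
    · intro h2; simp at h2
  · refine ⟨rfl, by simp, rfl, LynPeriod.init _, h, hi.le, fun h2 => ?_, fun _ => ⟨⟨h, ?_, ?_,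
      hi.le,
      Or.inl ⟨rfl, rfl⟩⟩, ?_, ?_⟩⟩
    · simp at h2
    · dsimp only; omega
    · dsimp only; omega
    · dsimp only; omega
    · dsimp only; omega

end WordRAM

/-! ### Copying a run -/

namespace WordRAM

/-- Copies the entries of the Lyndon word from `j` to `i` to all but the last of its repetitions. In
an increasing run the starting positions of the repetitions are put on the stack, and linked by
their distance `d`; in a decreasing run the word has been closed at `i`, and `d` is the entry of its
starting position as well. -/
def copyRun : Prog 19 := block [
  mov rA rL, mov rX rI, sub rB rD rOne, half rH rA,
  .while (.lt rB rH) (block [sub rA rA rD, add rX rX rD, half rH rA]),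
  .ite (.lt rJ rT) (block [sub rT rX rD, add rT rT rOne]) skip,
  store rI rD, add rI rI rOne, add rY rJ rOne,
  .while (.lt rI rX)
    (block [load rA rY, store rI rA, add rI rI rOne, add rY rY rOne])]

variable {γ : Type*} [LinearOrder γ] {f : ℕ → WithBot γ} {n : ℕ} {Q : View → Prop}

/-- The scan moves on by at least a third of `l`, because one copy and a part of another one are
left out of at least two. -/
theorem copyRun_wp (hf : Padded f n) (v : View) (hF : Found f n v.i v.t v.j v.d v.l v.A)
    (hdl : v.d ≤ v.l / 2)
    (hQ : ∀ u, v.i < u.i → Scan f n u.i u.t u.A → v.l ≤ 3 * (u.i - v.i) →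
      pot f u.t ≤ pot f v.t + 2 * (u.i - v.i) → u.tm ≤ v.tm + 10 * (u.i - v.i) + 20 → Q u) :
    copyRun.wp f n Q v := by
  have hjd : v.j < v.i ∧ v.d = v.i - v.j ∧ Lyn f v.j v.i ∧ Agree f v.j v.i v.l := by
    rcases hF.cand with h | h | h
    · omega
    · exact ⟨h.lt, h.d_eq, h.lyn, h.agree⟩
    · exact ⟨h.2.1, h.2.2.1, h.2.2.2.1, h.2.2.2.2⟩
  obtain ⟨hji, hd, hlyn, hag⟩ := hjd
  have hil := hF.le
  have hti := hF.scan.t_le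
  have hi : v.i = v.j + v.d := by omega
  -- the last loop, which copies the array to `m` repetitions
  have loop : ∀ m t a b h tm, 1 ≤ m → (m + 1) * v.d ≤ v.l → v.l < (m + 2) * v.d →
      tm ≤ v.tm + 4 * m + 8 →
      (v.j < v.t ∧ t = v.j + m * v.d + 1 ∨ v.t ≤ v.j ∧ t = v.t) →
      (block [store rI rD, add rI rI rOne, add rY rJ rOne,
        .while (.lt rI rX)
          (block [load rA rY, store rI rA, add rI rI rOne, add rY rY rOne])]).wp f n Q
      { v with t := t, a := a, b := b, h := h, x := v.i + m * v.d, tm := tm } := by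
    intro m t a b h tm hm hml hml2 htm ht
    have hH : Run f v.j v.d v.l m := ⟨by omega, hi ▸ hlyn, hi ▸ hag, hml⟩
    have e1 : (m + 1) * v.d = m * v.d + v.d := by ring
    have e2 : (m + 2) * v.d = m * v.d + 2 * v.d := by ring
    have hmd : v.d ≤ m * v.d := Nat.le_mul_of_pos_left _ hm
    have hmd' : m ≤ m * v.d := Nat.le_mul_of_pos_right _ (by omega)
    simp only [block, load, add, store, Prog.wp, Instr.wp, Test.safe, Test.holds, View.get,
      View.set, View.tick]
    refine ⟨by omega, by decide, by omega, by decide, by omega, ?_⟩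
    refine ⟨fun u => ∃ k A' a' tm', u = { v with
        t := t, a := a', b := b, h := h, x := v.i + m * v.d, i := v.i + k, y := v.j + k,
        A := A', tm := tm' } ∧ 1 ≤ k ∧ k ≤ m * v.d ∧ (∀ x < v.i, A' x = v.A x) ∧ A' v.i = v.d ∧
        (∀ x, v.i < x → x < v.i + k → A' x = A' (x - v.d)) ∧ tm' ≤ tm + 5 * k, fun u => n - u.i,
        ⟨1, _, _, _, rfl, le_rfl, by omega, fun x hx => Function.update_of_ne (by omega) _ _,
          Function.update_self _ _ _, by omega, by omega⟩, ?_⟩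
    rintro _ ⟨k, A', a', tm', rfl, h1, h2, h3, h4, h5, h6⟩
    dsimp only
    refine ⟨trivial, fun h7 => ?_, fun h7 => ?_⟩
    · refine ⟨by decide, by omega, by omega, by decide, by omega, by decide, by omega,
        ⟨k + 1, _, _, _, rfl, by omega, by omega, fun x hx => ?_, ?_, fun x hx1 hx2 => ?_,
        by omega⟩,
        by omega⟩
      · rw [Function.update_of_ne (by omega), h3 x hx]
      · rw [Function.update_of_ne (by omega), h4]
      · rw [Function.update_of_ne (a := x - v.d) (by omega)]
        rcases eq_or_ne x (v.i + k) with rfl | h8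
        · rw [Function.update_self]; congr 1; omega
        · rw [Function.update_of_ne h8]
          exact h5 x hx1 (by omega)
    · obtain rfl : k = m * v.d := by omega
      rw [hi] at h3 h4 h5
      have e3 : v.i + m * v.d = v.j + v.d + m * v.d := by rw [hi]
      rcases ht with ⟨k1, k2⟩ | ⟨k1, k2⟩
      · have hc : v.t = v.j + 1 := by
          rcases hF.cand with h | h | h
          · omega
          · have := h.t_le; omega
          · exact h.1
        have hlt : SLt f v.j (v.j + v.d) := hi ▸ hF.top_sLt v.j hc.symm
        have hs := hF.scan
        rw [hc, hi] at hs
        refine hQ _ (by dsimp only; omega) ?_ (by dsimp only; omega) ?_ (by dsimp only; omega)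
        · dsimp only
          rw [k2, e3]
          exact hs.run_inc hH hlt hm (by omega) h3 h4 h5
        · have := hH.pot_le hlt (r := m) le_rfl
          dsimp only
          rw [k2, hc]; omega
      · have hc : Popped f v.i v.t v.j v.d v.l := by
          rcases hF.cand with h | h | h
          · omega
          · exact h
          · omega
        have hs := hF.scan
        rw [hi] at hs
        refine hQ _ (by dsimp only; omega) ?_ (by dsimp only; omega) ?_ (by dsimp only; omega)
        · dsimp only
          rw [k2, e3]
          exact hs.run_dec hf hH k1 (hi ▸ hF.top_sLt) (hi ▸ hc.gt) hm (by omega) h3 h4 h5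
        · dsimp only; rw [k2]; omega
  simp only [copyRun, block, load, add, sub, mov, half, skip, store, Prog.wp, Instr.wp, Test.safe,
    Test.holds, View.get, View.set, View.tick, pow_one] at loop ⊢
  refine ⟨by decide, by decide, by decide, by omega, by decide, ?_⟩
  refine ⟨fun u => ∃ m tm', u = { v with
      a := v.l - m * v.d, x := v.i + m * v.d, b := v.d - 1, h := (v.l - m * v.d) / 2, tm := tm' } ∧
      (m + 1) * v.d ≤ v.l ∧ tm' ≤ v.tm + 4 * m + 4, fun u => u.a,
      ⟨0, v.tm + 1 + 1 + 1 + 1, by simp, by omega, by omega⟩, ?_⟩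
  rintro _ ⟨m, tm', rfl, h1, h2⟩
  have e1 : (m + 1) * v.d = m * v.d + v.d := by ring
  dsimp only
  refine ⟨trivial, fun h3 => ⟨by decide, by omega, by decide, by omega, by decide,
    ⟨m + 1, tm' + 1 + 1 + 1 + 1, ?_, ?_, by omega⟩, by omega⟩,
    fun h3 => ⟨trivial, fun h4 => ?_, fun h4 => ?_⟩⟩
  · rw [e1, Nat.sub_add_eq, Nat.add_assoc v.i]
  · rw [Nat.succ_mul, e1]; omega
  · have hm : 1 ≤ m := by
      by_contra h0
      obtain rfl : m = 0 := by omega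
      simp at h3; omega
    have hmd : v.d ≤ m * v.d := Nat.le_mul_of_pos_left _ hm
    refine ⟨by decide, by omega, by decide, by omega,
      loop m _ _ _ _ _ hm h1 ?_ ?_ (Or.inl ⟨h4, ?_⟩)⟩
    · rw [show (m + 2) * v.d = m * v.d + 2 * v.d by ring]; omega
    · omega
    · omega
  · have hm : 1 ≤ m := by
      by_contra h0
      obtain rfl : m = 0 := by omega
      simp at h3; omega
    refine loop m _ _ _ _ _ hm h1 ?_ ?_ (Or.inr ⟨by omega, rfl⟩)
    · rw [show (m + 2) * v.d = m * v.d + 2 * v.d by ring]; omega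
    · omega

end WordRAM

/-! ### Copying a part of a word -/

section Window

variable {γ : Type*} [LinearOrder γ] {f : ℕ → WithBot γ} {n : ℕ}

/-- The word of length `4 * r` at `j`, in front of a position `i` with known next smaller suffixes,
has `c` as its least suffix that starts in the second quarter, and `c + p` is the least suffix that
follows within distance `r` and not behind the next smaller suffix of `c`. -/
structure Root (f : ℕ → WithBot γ) (j r c p : ℕ) : Prop where
  pos : 0 < p
  le : p ≤ r
  ge : j + r ≤ c
  lt : c < j + 2 * r
  min : ∀ z, j + r ≤ z → z < j + 2 * r → z ≠ c → SLt f c z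
  next : ∃ v, IsNss f c v ∧ c + p ≤ v ∧
    ∀ z, c < z → z ≤ v → z ≤ c + r → z ≠ c + p → SLt f (c + p) z

/-- The candidate for a repeated word is a Lyndon word. -/
theorem Root.lyn {j r c p : ℕ} (h : Root f j r c p) : Lyn f c (c + p) := by
  obtain ⟨v, h1, h2, h3⟩ := h.next
  have := h.le
  exact lyn_of_sLt (fun x k1 k2 => h1.between x k1 (by omega))
    fun x k1 k2 => h3 x k1 (by omega) (by omega) (by omega)

/-- If `c'` is the first position that is congruent to `c` modulo `p` in the part of the string that
has period `p` and reaches the end `e` of the word at `j`, then no Lyndon word before `c' + p` is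
repeated up to `e`. -/
theorem Root.not_agree {j r c p e c' s k x y : ℕ} (h : Root f j r c p) (he : j + 4 * r ≤ e)
    (hs : ∀ x, j ≤ x → (∀ y, x ≤ y → y + p < e → f y = f (y + p)) → s ≤ x)
    (hc : c = c' + k * p) (hc' : c' < s + p) (hx : j ≤ x) (hxy : x < y) (hy : y < j + r)
    (hy' : y < c' + p) (hl : Lyn f x y) : ¬ Agree f x y (e - y) := by
  intro ha
  obtain ⟨v, h1, h2, h3⟩ := h.next
  have h0 := h.pos
  obtain ⟨h4, q, h5⟩ := root_of_period he h.ge h.lt h.min h1 (by omega) h2 (by have := h.le; omega)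
    h3 hx hxy hy hl ha
  obtain rfl : y = x + p := by omega
  rw [show x + p - x = p by omega] at h5
  have h6 : s ≤ x := hs x hx fun z hz1 hz2 => by
    have := ha (z - x) (by omega)
    rwa [show x + (z - x) = z by omega, show x + p + (z - x) = z + p by omega] at this
  rcases Nat.lt_or_ge k q with h7 | h7
  · have := Nat.mul_le_mul_right p (Nat.succ_le_of_lt h7)
    rw [Nat.succ_mul] at this
    omega
  · have := Nat.mul_le_mul_right p h7
    omega

end Window

namespace WordRAM

/-- Follows the next smaller suffixes from `b` on, up to the last position before `x`. -/
def chain : Prog 19 := block [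
  load rA rB, add rA rB rA,
  .while (.lt rA rX) (block [mov rB rA, load rA rB, add rA rB rA])]

/-- Finds the position `c` and the length `p` of the only Lyndon word that may be repeated up to the
end of the word at `j`. -/
def findRoot : Prog 19 := block [
  add rB rJ rH, add rX rB rH, chain, mov rC rB, add rX rC rH,
  .ite (.lt rA rX) (mov rX rA) skip,
  add rX rX rOne, add rB rC rOne, chain, sub rP rB rC]

/-- Finds the first position `a` from which on the word at `j` of length `l` has period `p`. -/
def extendLeft : Prog 19 := block [
  add rA rJ rL, mov rB rA, sub rA rA rP, mov rE rOne,
  .while (.lt rZero rE)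
    (.ite (.lt rJ rA)
      (block [sub rX rA rOne, sub rY rB rOne,
        .ite (.symEq rX rY) (block [mov rA rX, mov rB rY]) (mov rE rZero)])
      (mov rE rZero))]

/-- Moves `c` back by multiples of `p` to its first repetition in the periodic part that starts at
`a`. -/
def firstRoot : Prog 19 := block [
  add rX rA rP, sub rX rX rOne, .while (.lt rX rC) (sub rC rC rP)]

/-- Copies the entries of the array between `y` and `x` to the positions from `i` on. Entries that
belong to the stack are linked to the previous element of the stack. -/
def copyWindow : Prog 19 :=
  .while (.lt rY rX) (block [
    load rA rY, add rB rY rA,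
    .ite (.lt rB rX) (store rI rA)
      (block [add rB rI rOne, sub rA rB rT, store rI rA, mov rT rB]),
    add rY rY rOne, add rI rI rOne])

variable {γ : Type*} [LinearOrder γ] {f : ℕ → WithBot γ} {n : ℕ} {Q : View → Prop}

theorem chain_wp (v : View) (hx : v.b < v.x) (hn : v.x ≤ n)
    (hA : ∀ z, v.b ≤ z → z < v.x → IsNss f z (z + v.A z) ∧ z + v.A z ≤ n)
    (hQ : ∀ b tm', v.b ≤ b → b < v.x → v.x ≤ b + v.A b →
      (∀ z, v.b ≤ z → z < v.x → z ≠ b → SLt f b z) → tm' ≤ v.tm + 4 * (b - v.b) + 3 →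
      Q { v with a := b + v.A b, b := b, tm := tm' }) :
    chain.wp f n Q v := by
  have hb := (hA v.b le_rfl hx).2
  simp only [chain, block, load, add, mov, Prog.wp, Instr.wp, Test.safe, Test.holds, View.get,
    View.set, View.tick]
  refine ⟨by decide, by omega, by decide, hb, ?_⟩
  refine ⟨fun u => ∃ b tm', u = { v with a := b + v.A b, b := b, tm := tm' } ∧ v.b ≤ b ∧ b < v.x ∧
    (∀ z, v.b ≤ z → z < b → SLt f b z) ∧ tm' ≤ v.tm + 4 * (b - v.b) + 2, fun u => n + 1 - u.b,
    ⟨v.b, _, rfl, le_rfl, hx, by omega, by omega⟩, ?_⟩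
  rintro _ ⟨b, tm', rfl, h1, h2, h3, h4⟩
  obtain ⟨h5, h6⟩ := hA b h1 h2
  have h7 := h5.lt
  dsimp only
  refine ⟨trivial, fun h8 => ?_, fun h8 => ?_⟩
  · obtain ⟨h9, h10⟩ := hA (b + v.A b) (by omega) h8
    refine ⟨by decide, by decide, by omega, by decide, h10,
      ⟨b + v.A b, _, rfl, by omega, h8, fun z k1 k2 => ?_, by omega⟩, by omega⟩
    rcases lt_trichotomy z b with k3 | rfl | k3
    · exact h5.sLt.trans (h3 z k1 k3)
    · exact h5.sLt
    · exact h5.sLt.trans (h5.between z k3 k2)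
  · refine hQ b _ h1 h2 (by omega) (fun z k1 k2 k3 => ?_) (by omega)
    rcases lt_or_gt_of_ne k3 with k4 | k4
    · exact h3 z k1 k4
    · exact h5.between z k4 (by omega)

theorem findRoot_wp (v : View) (hr : 0 < v.h) (hi : v.j + 4 * v.h ≤ n)
    (hA : ∀ z, v.j < z → z < v.j + 4 * v.h → IsNss f z (z + v.A z) ∧ z + v.A z ≤ n)
    (hQ : ∀ c p a b x tm', Root f v.j v.h c p → tm' ≤ v.tm + 8 * v.h + 15 →
      Q { v with c := c, p := p, a := a, b := b, x := x, tm := tm' }) :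
    findRoot.wp f n Q v := by
  have second : ∀ c x tm, v.j + v.h ≤ c → c < v.j + 2 * v.h →
      (∀ z, v.j + v.h ≤ z → z < v.j + 2 * v.h → z ≠ c → SLt f c z) →
      x = min (c + v.A c) (c + v.h) → tm ≤ v.tm + 4 * v.h + 9 →
      (block [add rX rX rOne, add rB rC rOne, chain, sub rP rB rC]).wp f n Q
        { v with c := c, a := c + v.A c, b := c, x := x, tm := tm } := by
    intro c x tm h1 h2 h3 hx htm
    obtain ⟨h4, h5⟩ := hA c (by omega) (by omega)
    have h6 := h4.lt
    simp only [block, add, sub, Prog.wp, Instr.wp, View.get, View.set, View.tick]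
    refine ⟨by decide, by omega, by decide, by omega, ?_⟩
    refine chain_wp _ (by dsimp only; omega) (by dsimp only; omega) (fun z k1 k2 => ?_) ?_
    · dsimp only at k1 k2 ⊢
      exact hA z (by omega) (by omega)
    intro b tm' k1 k2 k3 k4 k5
    dsimp only at k1 k2 k3 k4 k5 ⊢
    refine ⟨by decide, by omega, hQ _ _ _ _ _ _ ⟨by omega, by omega, h1, h2, h3, c + v.A c, h4,
      by omega, fun z l1 l2 l3 l4 => ?_⟩ (by omega)⟩
    rw [show c + (b - c) = b by omega] at l4 ⊢
    exact k4 z (by omega) (by omega) l4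
  simp only [findRoot, block, add, sub, mov, skip, Prog.wp, Instr.wp, Test.safe, Test.holds,
    View.get, View.set, View.tick] at second ⊢
  refine ⟨by decide, by omega, by decide, by omega, ?_⟩
  refine chain_wp _ (by dsimp only; omega) (by dsimp only; omega) (fun z k1 k2 => ?_) ?_
  · dsimp only at k1 k2 ⊢
    exact hA z (by omega) (by omega)
  intro c tm' k1 k2 k3 k4 k5
  dsimp only at k1 k2 k3 k4 k5 ⊢
  have k6 : ∀ z, v.j + v.h ≤ z → z < v.j + 2 * v.h → z ≠ c → SLt f c z := fun z l1 l2 l3 =>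
    k4 z l1 (by omega) l3
  refine ⟨by decide, by decide, by omega, trivial, fun h1 => ⟨by decide, ?_⟩, fun h1 => ?_⟩
  · exact second c _ _ (by omega) (by omega) k6 (by omega) (by omega)
  · exact second c _ _ (by omega) (by omega) k6 (by omega) (by omega)

theorem extendLeft_wp (v : View) (hp : 0 < v.p) (hpl : v.p ≤ v.l) (hn : v.j + v.l ≤ n)
    (hQ : ∀ a b x y e tm', v.j ≤ a → a + v.p ≤ v.j + v.l →
      (∀ y, a ≤ y → y + v.p < v.j + v.l → f y = f (y + v.p)) →
      (∀ x, v.j ≤ x → (∀ y, x ≤ y → y + v.p < v.j + v.l → f y = f (y + v.p)) → a ≤ x) →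
      tm' ≤ v.tm + 7 * v.l + 8 →
      Q { v with a := a, b := b, x := x, y := y, e := e, tm := tm' }) :
    extendLeft.wp f n Q v := by
  simp only [extendLeft, block, add, sub, mov, Prog.wp, Instr.wp, Test.safe, Test.holds, View.get,
    View.set, View.tick]
  refine ⟨by decide, hn, by decide, by decide, by omega, by decide, ?_⟩
  refine ⟨fun u => ∃ a x y e tm',
    u = { v with a := a, b := a + v.p, x := x, y := y, e := e, tm := tm' } ∧
    v.j ≤ a ∧ a + v.p ≤ v.j + v.l ∧ (∀ y, a ≤ y → y + v.p < v.j + v.l → f y = f (y + v.p)) ∧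
    (e = 0 → ∀ x, v.j ≤ x → (∀ y, x ≤ y → y + v.p < v.j + v.l → f y = f (y + v.p)) → a ≤ x) ∧
    tm' + 7 * (a - v.j) + 6 * e ≤ v.tm + 7 * v.l + 7 ∧ e ≤ 1, fun u => u.a + u.e,
    ⟨v.j + v.l - v.p, v.x, v.y, 1, v.tm + 1 + 1 + 1 + 1, ?_, by omega, by omega, by omega, by omega,
      by omega, by omega⟩, ?_⟩
  · rw [show v.j + v.l - v.p + v.p = v.j + v.l by omega]
  rintro _ ⟨a, x, y, e, tm', rfl, h1, h2, h3, h4, h5, h6⟩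
  dsimp only
  refine ⟨trivial, fun h7 => ⟨trivial, fun h8 => ⟨by decide, by omega, by decide, by omega,
    ⟨by omega, by omega⟩, fun h9 => ?_, fun h9 => ?_⟩, fun h8 => ?_⟩, fun h7 => ?_⟩
  · refine ⟨by decide, by decide, ⟨a - 1, a - 1, a + v.p - 1, e, tm' + 1 + 1 + 1 + 1 + 1 + 1 + 1,
      ?_,
      by omega, by omega, fun z k1 k2 => ?_, by omega, by omega, h6⟩, by omega⟩
    · rw [show a - 1 + v.p = a + v.p - 1 by omega]
    · rcases Nat.lt_or_ge z a with k3 | k3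
      · obtain rfl : z = a - 1 := by omega
        rw [h9]; congr 1; omega
      · exact h3 z k3 k2
  · refine ⟨by decide, ⟨a, _, _, 0, _, rfl, h1, h2, h3, fun _ z k1 k2 => ?_, by omega, by omega⟩,
      by omega⟩
    by_contra k3
    refine h9 ?_
    rw [k2 (a - 1) (by omega) (by omega)]; congr 1; omega
  · refine ⟨by decide, ⟨a, _, _, 0, _, rfl, h1, h2, h3, fun _ z k1 k2 => by omega, by omega,
      by omega⟩, by omega⟩
  · exact hQ _ _ _ _ _ _ h1 h2 h3 (h4 (by omega)) (by omega)

theorem firstRoot_wp (v : View) (hp : 0 < v.p) (hn : v.a + v.p ≤ n)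
    (hQ : ∀ c k x tm', v.c = c + k * v.p → c < v.a + v.p → (c = v.c ∨ v.a ≤ c) →
      tm' ≤ v.tm + 2 * k + 3 → Q { v with c := c, x := x, tm := tm' }) :
    firstRoot.wp f n Q v := by
  simp only [firstRoot, block, add, sub, Prog.wp, Instr.wp, Test.safe, Test.holds, View.get,
    View.set, View.tick]
  refine ⟨by decide, hn, by decide, by omega, ?_⟩
  refine ⟨fun u => ∃ c k tm', u = { v with c := c, x := v.a + v.p - 1, tm := tm' } ∧
    v.c = c + k * v.p ∧ (c = v.c ∨ v.a ≤ c) ∧ tm' ≤ v.tm + 2 * k + 2, fun u => u.c,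
    ⟨v.c, 0, _, rfl, by omega, Or.inl rfl, by omega⟩, ?_⟩
  rintro _ ⟨c, k, tm', rfl, h1, h2, h3⟩
  dsimp only
  refine ⟨trivial, fun h4 => ⟨by decide, by omega, ⟨c - v.p, k + 1, _, rfl, ?_, by omega, by omega⟩,
    by omega⟩, fun h4 => hQ c k _ _ h1 (by omega) h2 (by omega)⟩
  rw [Nat.succ_mul]; omega

/-- At the end, the last copied position is on top of the stack, because its next smaller suffix
follows at once or later, and so is not among the copied positions. -/
theorem copyWindow_wp (hf : Padded f n) (v : View) {i Y L : ℕ} (H : Window f n i v.j L Y v.A)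
    (hY : 0 < Y) (hi : v.i = i + 1) (ht : v.t = i + 1) (hx : v.x = v.j + Y) (hy : v.y = v.j + 1)
    (hs : Scan f n (i + 1) (i + 1) v.A)
    (hA : ∀ z, v.j < z → z < v.j + Y → z + v.A z ≤ n)
    (hQ : ∀ u, u.i = i + Y → u.t = i + Y → Scan f n (i + Y) (i + Y) u.A →
      pot f (i + Y) ≤ pot f (i + 1) + 2 * (Y - 1) → u.tm ≤ v.tm + 10 * Y + 1 → Q u) :
    copyWindow.wp f n Q v := by
  have hle := H.le
  have hin := H.i_le
  have hYL := H.Y_le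
  simp only [copyWindow, block, load, store, add, sub, mov, Prog.wp, Instr.wp, Test.safe,
    Test.holds, View.get, View.set, View.tick]
  -- `o` is the offset of the top of the stack
  refine ⟨fun u => ∃ k o A' a b tm',
    u = { v with i := i + k, t := i + o + 1, y := v.j + k, A := A', a := a, b := b, tm := tm' } ∧
    1 ≤ k ∧ k ≤ Y ∧ o < k ∧ (o = 0 ∨ Y ≤ o + v.A (v.j + o)) ∧
    (∀ z, o < z → z < k → z + v.A (v.j + z) < Y) ∧ (∀ z ≤ i, A' z = v.A z) ∧
    (∀ z, 0 < z → z < k → z + v.A (v.j + z) < Y → A' (i + z) = v.A (v.j + z)) ∧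
    (∀ z, 0 < z → z < k → Y ≤ z + v.A (v.j + z) → A' (i + z) = i + z + 1 - prevEnd f (i + z)) ∧
    pot f (i + o + 1) ≤ pot f (i + 1) + 2 * o ∧ tm' ≤ v.tm + 10 * k, fun u => n + 1 - u.i,
    ⟨1, 0, v.A, v.a, v.b, v.tm, ?_, le_rfl, hY, by omega, by omega, by omega, by simp, by omega,
      by omega, by simp, by omega⟩, ?_⟩
  · rw [Nat.add_zero, ← hy, ← ht]
    nth_rewrite 1 [ht, ← hi]
    rfl
  rintro _ ⟨k, o, A', a, b, tm', rfl, h1, h2, h3, h4, h5, h6, h7, h8, h9, h10⟩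
  dsimp only
  refine ⟨trivial, fun hk => ?_, fun hk => ?_⟩
  · have e1 : A' (v.j + k) = v.A (v.j + k) := h6 _ (by omega)
    rw [e1]
    refine ⟨by decide, by omega, by decide, hA _ (by omega) (by omega), trivial, fun h11 => ?_,
      fun h11 => ?_⟩
    · refine ⟨by omega, by decide, by omega, by decide, by omega, ⟨k + 1, o, _, _, _, _, rfl,
        by omega, by omega, by omega, h4, fun z k1 k2 => ?_, fun z k1 => ?_, fun z k1 k2 k3 => ?_,
        fun z k1 k2 k3 => ?_, h9, by omega⟩, by omega⟩
      · rcases Nat.lt_succ_iff_lt_or_eq.1 k2 with k3 | rfl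
        · exact h5 z k1 k3
        · omega
      · rw [Function.update_of_ne (by omega), h6 z k1]
      · rcases Nat.lt_succ_iff_lt_or_eq.1 k2 with k4 | rfl
        · rw [Function.update_of_ne (by omega), h7 z k1 k4 k3]
        · rw [Function.update_self]
      · rcases Nat.lt_succ_iff_lt_or_eq.1 k2 with k4 | rfl
        · rw [Function.update_of_ne (by omega), h8 z k1 k4 k3]
        · omega
    · have h12 : prevEnd f (i + k) = i + o + 1 := H.prevEnd_copy hf h3 (by omega) h4 (by omega) h5
      refine ⟨by decide, by omega, by decide, by omega, by omega, by decide, by decide, by omega,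
        by decide, by omega, ⟨k + 1, k, _, _, _, _, rfl, by omega, by omega, by omega,
        Or.inr (by omega), by omega, fun z k1 => ?_, fun z k1 k2 k3 => ?_, fun z k1 k2 k3 => ?_, ?_,
        by omega⟩, by omega⟩
      · rw [Function.update_of_ne (by omega), h6 z k1]
      · rcases Nat.lt_succ_iff_lt_or_eq.1 k2 with k4 | rfl
        · rw [Function.update_of_ne (by omega), h7 z k1 k4 k3]
        · omega
      · rcases Nat.lt_succ_iff_lt_or_eq.1 k2 with k4 | rfl
        · rw [Function.update_of_ne (by omega), h8 z k1 k4 k3]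
        · rw [Function.update_self, h12]
      · have h13 := overlap_le (f := f) (i + k)
        rw [pot_succ, h12]
        rw [h12] at h13
        omega
  · obtain rfl : k = Y := by omega
    have h11 : o + 1 = k := by
      by_contra h11
      have h12 := (H.closed (k - 1) (by omega) (by omega)).lt
      have h13 := h5 (k - 1) (by omega) (by omega)
      omega
    rw [Nat.add_assoc i o 1, h11] at h9
    refine hQ _ (by dsimp only) (by dsimp only; omega) ?_ (by omega) (by dsimp only; omega)
    exact H.scan hf hs hY h6 h7 h8

end WordRAM

namespace WordRAM

/-- Copies the next smaller suffixes from the word at `j` to its copy at `i`, as far as the two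
words determine that they are the same. -/
def copyPart : Prog 19 := block [
  findRoot, extendLeft, firstRoot,
  add rX rC rP, add rY rJ rH, .ite (.lt rX rY) skip (mov rX rY),
  add rY rJ rOne, add rI rI rOne, copyWindow]

variable {γ : Type*} [LinearOrder γ] {f : ℕ → WithBot γ} {n : ℕ} {Q : View → Prop}

/-- Either the full first quarter of the word is copied, or the scan arrives at the end of a Lyndon
word that is repeated for the rest of the copy, which is at least three quarters of it. -/
theorem copyPart_wp (hf : Padded f n) (v : View) (hr : 0 < v.h) (hL : 4 * v.h ≤ v.l)
    (hji : v.j + v.l ≤ v.i) (hi : v.i + v.l ≤ n) (hlyn : Lyn f v.j v.i) (ha : Agree f v.j v.i v.l)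
    (hA : ∀ z, v.j < z → z < v.i → IsNss f z (z + v.A z) ∧ z + v.A z ≤ n)
    (ht : v.t = v.i + 1) (hs : Scan f n (v.i + 1) (v.i + 1) v.A)
    (hQ : ∀ u Y, 0 < Y → Y ≤ v.h → u.i = v.i + Y → u.t = v.i + Y →
      Scan f n (v.i + Y) (v.i + Y) u.A → pot f (v.i + Y) ≤ pot f (v.i + 1) + 2 * (Y - 1) →
      (Y = v.h ∨ ∃ j₀ E, Repeats f (v.i + Y) j₀ E ∧ 3 * v.h ≤ E) →
      u.tm ≤ v.tm + 7 * v.l + 22 * v.h + 40 → Q u) :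
    copyPart.wp f n Q v := by
  simp only [copyPart, block, Prog.wp]
  refine findRoot_wp v hr (by omega) (fun z h1 h2 => hA z h1 (by omega)) ?_
  intro c p a b x tm hR htm
  have hp := hR.pos
  have hpr := hR.le
  have hc1 := hR.ge
  have hc2 := hR.lt
  refine extendLeft_wp _ hp (by dsimp only; omega) (by dsimp only; omega) ?_
  intro s b x y e tm1 hs1 hs2 hs3 hs4 htm1
  dsimp only at hs1 hs2 hs3 hs4 htm1 ⊢
  refine firstRoot_wp _ hp (by dsimp only; omega) ?_
  intro c' k x tm2 hk hc3 hc4 htm2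
  dsimp only at hk hc3 hc4 htm2 ⊢
  have hkp : k ≤ k * p := Nat.le_mul_of_pos_right _ hp
  have hcj : v.j ≤ c' := by omega
  -- the last part, where `Y` positions are copied
  have last : ∀ Y tm, Y = min (c' + p) (v.j + v.h) - v.j → tm ≤ v.tm + 7 * v.l + 12 * v.h + 30 →
      (block [add rY rJ rOne, add rI rI rOne, copyWindow]).wp f n Q
        { v with c := c', p := p, a := s, b := b, x := v.j + Y, y := v.j + v.h, e := e,
                 tm := tm } := by
    intro Y tm hY htm
    have hYr : Y ≤ v.h := by omega
    have hY0 : 0 < Y := by omega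
    simp only [block, add, Prog.wp, Instr.wp, View.get, View.set, View.tick]
    refine ⟨by decide, by omega, by decide, by omega, ?_⟩
    refine copyWindow_wp hf _ (i := v.i) (Y := Y) (L := v.l) ?_ hY0 rfl ht rfl rfl hs ?_ ?_
    · refine ⟨by dsimp only; omega, hji, hi, hlyn, ha, fun x h1 h2 => ?_, by omega,
        fun x y h1 h2 h3 => ?_⟩
      · exact (hA _ (by dsimp only; omega) (by dsimp only; omega)).1
      · dsimp only at h3 ⊢
        have h4 := hR.not_agree (e := v.j + v.l) (by omega) hs4 hk hc3 (x := v.j + x) (y := v.j + y)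
          (by omega) (by omega) (by omega) (by omega) h3
        rwa [show v.j + v.l - (v.j + y) = v.l - y by omega] at h4
    · exact fun z h1 h2 => (hA z h1 (by dsimp only at h2; omega)).2
    · intro u h1 h2 h3 h4 h5
      dsimp only at h5
      refine hQ u Y hY0 hYr h1 h2 h3 h4 ?_ (by omega)
      rcases hYr.eq_or_lt with h6 | h6
      · exact Or.inl h6
      -- the root `c'` is repeated in front of the second quarter, so it lies in the periodic part
      have h7 : v.j + Y = c' + p := by omega
      have h8 : s ≤ c' := by omega
      obtain ⟨q, rfl⟩ : ∃ q, c' = v.j + q := ⟨c' - v.j, by omega⟩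
      have h9 : Lyn f (v.j + q) (v.j + q + p) := by
        refine hR.lyn.transfer (by omega) fun g hg => ?_
        have := period_mul hs3 (y := v.j + q + g) (k := k) (by omega) (by omega)
        rw [this, hk]; congr 1; omega
      have h10 : Agree f (v.j + q) (v.j + q + p) (v.l - Y) := fun g hg => by
        have := hs3 (v.j + q + g) (by omega) (by omega)
        rw [this]; congr 1; omega
      have e1 : v.i + Y = v.i + q + p := by omega
      have h11 := (ha.shift (s := q) (by omega))
      have h12 := (ha.shift (s := q + p) (by omega))
      rw [← Nat.add_assoc, ← Nat.add_assoc] at h12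
      refine Or.inr ⟨v.i + q, v.l - Y, ⟨by omega, ?_, ?_, by omega⟩, by omega⟩
      · rw [e1]
        exact h9.transfer (by omega) (h11.mono (by omega))
      · rw [e1]
        exact (h11.symm.mono (by omega)).trans (h10.trans (h12.mono (by omega)))
  simp only [block, add, mov, skip, Prog.wp, Instr.wp, Test.safe, Test.holds, View.get, View.set,
    View.tick] at last ⊢
  refine ⟨by decide, by omega, by decide, by omega, trivial, fun h1 => ?_,
    fun h1 => ⟨by decide, ?_⟩⟩
  · have := last (c' + p - v.j) (tm2 + 1 + 1 + 1 + 1) (by omega) (by omega)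
    rwa [show v.j + (c' + p - v.j) = c' + p by omega] at this
  · exact last v.h _ (by omega) (by omega)

/-- Puts `i` on the stack, and copies what is known from the candidate `j`. -/
def window : Prog 19 := block [
  add rA rI rOne, sub rA rA rT, store rI rA, add rT rI rOne,
  .ite (.lt rD rL) (mov rL rD) skip,
  half rH rL, half rH rH,
  .ite (.lt rZero rH) copyPart (add rI rI rOne)]

/-- The time is proportional to `l`, and so is either the number of positions that are copied or the
length of a repetition that starts afterwards. The new elements of the stack contribute the overlap
of `i` with the previous smaller suffix, at most `l`, and twice the number of copied positions. -/
theorem window_wp (hf : Padded f n) (v : View) (hi : v.i < n)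
    (hF : Found f n v.i v.t v.j v.d v.l v.A) (hdl : v.l / 2 < v.d)
    (hQ : ∀ u, v.i < u.i → u.t = u.i → Scan f n u.i u.i u.A →
      pot f u.i ≤ pot f v.t + v.l + 1 + 2 * (u.i - v.i) →
      (v.l ≤ 8 * (u.i - v.i) + 7 ∨
        ∃ j₀ E, Repeats f u.i j₀ E ∧ u.i - v.i ≤ E ∧ v.l ≤ 5 * E) →
      u.tm ≤ v.tm + 13 * v.l + 50 → Q u) :
    window.wp f n Q v := by
  have hs := hF.scan
  have hti := hs.t_le
  have hil := hF.le
  have hpush := hs.push hf hi hF.top_sLt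
  have hpot : pot f (v.i + 1) ≤ pot f v.t + v.l + 1 := by
    have h1 := hs.prevEnd_eq hF.top_sLt
    have h2 : overlap f v.i ≤ v.l := overlap_le_of_not_agree fun y hy => hF.most y (by omega)
    rw [pot_succ, h1]; omega
  have rest : ∀ L tm, L = min v.l v.d → tm ≤ v.tm + 6 →
      (block [half rH rL, half rH rH, .ite (.lt rZero rH) copyPart (add rI rI rOne)]).wp f n Q
        { v with l := L, a := v.i + 1 - v.t, t := v.i + 1,
                 A := Function.update v.A v.i (v.i + 1 - v.t), tm := tm } := by
    intro L tm hL htm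
    simp only [block, half, add, Prog.wp, Instr.wp, Test.safe, Test.holds, View.get,
      View.set, View.tick, pow_one]
    refine ⟨by decide, by decide, trivial, fun h1 => ?_, fun h1 => ⟨by decide, by omega, ?_⟩⟩
    · have hjd : v.t ≤ v.j + 1 ∧ v.j < v.i ∧ v.d = v.i - v.j ∧ Lyn f v.j v.i ∧
          Agree f v.j v.i v.l := by
        rcases hF.cand with h | h | h
        · omega
        · have := h.t_le
          exact ⟨by omega, h.lt, h.d_eq, h.lyn, h.agree⟩
        · exact ⟨h.1.le, h.2⟩
      obtain ⟨k1, k2, k3, k4, k5⟩ := hjd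
      refine copyPart_wp hf _ h1 (by dsimp only; omega) (by dsimp only; omega)
        (by dsimp only; omega)
        k4 (k5.mono (by dsimp only; omega)) (fun z h2 h3 => ?_) rfl hpush ?_
      · dsimp only at h2 h3 ⊢
        rw [Function.update_of_ne (by omega)]
        have h4 := hs.closed z h3 (Or.inl (by omega))
        have h5 := h4.le_of_sLt h3 (hs.gap z (by omega) h3)
        exact ⟨h4, by omega⟩
      · intro u Y h2 h3 h4 h5 h6 h7 h8 h9
        dsimp only at h2 h3 h4 h5 h6 h7 h8 h9
        rw [← h4] at h5 h6 h7 h8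
        refine hQ u (by omega) h5 h6 (by omega) ?_ (by omega)
        rcases h8 with h8 | ⟨j₀, E, h8, h10⟩
        · left; omega
        · exact Or.inr ⟨j₀, E, h8, by omega, by omega⟩
    · exact hQ _ (by dsimp only; omega) rfl hpush (by dsimp only; omega)
        (Or.inl (by dsimp only; omega))
        (by dsimp only; omega)
  simp only [window, block, half, add, sub, mov, store, skip, Prog.wp, Instr.wp, Test.safe,
    Test.holds, View.get, View.set, View.tick] at rest ⊢
  refine ⟨by decide, by omega, by decide, by omega, hi, by decide, by omega, trivial,
    fun h1 => ⟨by decide, ?_⟩, fun h1 => ?_⟩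
  · exact rest v.d _ (by omega) (by omega)
  · exact rest v.l _ (by omega) (by omega)

/-! ### The scan -/

/-- The scan from left to right. -/
def scanAll : Prog 19 :=
  .while (.lt rI rN) (block [findPrev, half rH rL, .ite (.lt rH rD) window copyRun])

/-- Removes all suffixes from the stack, as the end of the string is smaller than all of them. -/
def closeAll : Prog 19 :=
  .while (.lt rZero rT)
    (block [sub rZ rT rOne, load rC rZ, sub rX rI rZ, store rZ rX, sub rT rT rC])

/-- The time of the scan is linear in the number of positions that have been processed. A repetition
that has been detected, but not been copied yet, may pay for the time that it took to detect it. -/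
theorem scanAll_wp (hf : Padded f n) (v : View) (hi : v.i = 0) (ht : v.t = 0)
    (hQ : ∀ u, u.i = n → Scan f n n u.t u.A → u.tm ≤ v.tm + 2000 * n + 1 → Q u) :
    scanAll.wp f n Q v := by
  simp only [scanAll, block, half, Prog.wp, Instr.wp, Test.safe, Test.holds, View.get, View.set,
    View.tick, pow_one]
  -- `E` is the length of a detected repetition that has not been copied, and `0` if there is none
  -- The factor 50 of the potential is that of `findPrev_wp`; 500 covers a step of `window` that ends
  -- at a repetition, per symbol of the repetition, and 2000 covers all steps that move `i` on, per
  -- position, including the debt of 500 for each of the up to three times as many symbols of a run.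
  refine ⟨fun u => Scan f n u.i u.t u.A ∧ ∃ E, (E = 0 ∨ ∃ j₀, Repeats f u.i j₀ E ∧ j₀ < u.t) ∧
    u.tm + 50 * pot f u.t ≤ v.tm + 2000 * u.i + 500 * E, fun u => n - u.i,
    ⟨?_, 0, Or.inl rfl, ?_⟩, ?_⟩
  · rw [hi, ht]; exact Scan.init _
  · rw [ht, pot_zero]; omega
  rintro u ⟨hs, E, hE, htm⟩
  refine ⟨trivial, fun hin => ?_, fun hin => ?_⟩
  · refine findPrev_wp hf _ hin hs ?_
    intro u1 h1 hF hrep htm1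
    dsimp only at h1 hrep htm1
    have hE' : E = 0 ∨ 2 * u1.d ≤ u1.l ∧ E ≤ u1.l := by
      rcases hE with h | ⟨j₀, h2, h3⟩
      · exact Or.inl h
      · exact Or.inr (hrep j₀ E (h1 ▸ h2) h3)
    refine ⟨by decide, trivial, fun h2 => ?_, fun h2 => ?_⟩
    · -- the search would have found a repetition again, so that there was none
      refine window_wp hf _ (by dsimp only; omega) hF h2 ?_
      intro u2 h3 h4 h5 h6 h7 h8
      dsimp only at h3 h6 h7 h8
      refine ⟨⟨h4.symm ▸ h5, ?_⟩, by dsimp only; omega⟩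
      rw [h4]
      rcases h7 with h7 | ⟨j₀, E', h7, h9, h10⟩
      · exact ⟨0, Or.inl rfl, by omega⟩
      · have h11 := h7.lt
        have h12 := h7.le
        exact ⟨E', Or.inr ⟨j₀, h7, h11⟩, by omega⟩
    · -- the run is at least as long as a repetition that was detected before
      refine copyRun_wp hf _ hF (by dsimp only; omega) ?_
      intro u2 h3 h4 h5 h6 h7
      dsimp only at h3 h5 h6 h7
      exact ⟨⟨h4, 0, Or.inl rfl, by omega⟩, by dsimp only; omega⟩
  · -- at the end of the string no repetition can be left
    have h1 : u.i = n := le_antisymm hs.i_le (by omega)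
    have h2 : E = 0 := by
      rcases hE with h | ⟨j₀, h3, _⟩
      · exact h
      · rw [h1] at h3
        have := hf.agree_le h3.lt le_rfl h3.agree
        omega
    exact hQ _ h1 (h1 ▸ hs) (by dsimp only; omega)

/-- After the stack has been emptied, the array holds the distances to all next smaller suffixes. -/
theorem closeAll_wp (hf : Padded f n) (v : View) (hi : v.i = n) (hs : Scan f n n v.t v.A)
    (hQ : ∀ u, (∀ x < n, IsNss f x (x + u.A x)) → u.tm ≤ v.tm + 6 * n + 1 → Q u) :
    closeAll.wp f n Q v := by
  have hle := hs.t_le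
  simp only [closeAll, block, load, store, sub, Prog.wp, Instr.wp, Test.safe, Test.holds, View.get,
    View.set, View.tick]
  refine ⟨fun u => u.i = n ∧ Scan f n n u.t u.A ∧ u.tm + 6 * u.t ≤ v.tm + 6 * n, fun u => u.t,
    ⟨hi, hs, by omega⟩, ?_⟩
  rintro u ⟨h1, h2, h3⟩
  have h4 := h2.t_le
  refine ⟨trivial, fun h5 => ?_, fun h5 => ?_⟩
  · obtain ⟨z, hz⟩ : ∃ z, z + 1 = u.t := ⟨u.t - 1, by omega⟩
    have e : u.t - 1 = z := by omega
    rw [← hz] at h2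
    have h6 := h2.arr_top
    have h7 := prevEnd_le (f := f) z
    have h8 := h2.pop hf (hf.end_sLt (by omega))
    have e2 : u.t - u.A z = prevEnd f z := by omega
    rw [e, e2]
    refine ⟨by decide, by omega, by decide, by omega, by decide, by omega, by omega, by decide,
      by omega, ⟨h1, ?_, by dsimp only; omega⟩, by dsimp only; omega⟩
    rw [h1]; exact h8
  · exact hQ _ (fun x hx => h2.closed x hx (Or.inl (by omega))) (by dsimp only; omega)

end WordRAM

/-! ### The program -/

namespace WordRAM

/-- The whole computation of the Lyndon array. -/
def lyndonArray : Prog 19 :=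
  .seq (.seq (.instr (.const rZero 0)) (.seq (.instr (.const rOne 1)) (.instr (.len rN))))
    (block [mov rI rZero, mov rT rZero, scanAll, closeAll])

theorem lyndonArray_exec {α : Type*} [LinearOrder α] (S : List α) {w : ℕ} (hn : S.length < 2 ^ w)
    (h1 : 1 < 2 ^ w) (s : State 19 w S.length) :
    ∃ t s', Exec S lyndonArray s t s' ∧ t ≤ 2006 * S.length + 8 ∧
      IsLyndonArray S fun i => (s'.arr i).toNat := by
  have hf := padded_padded S
  set s₁ : State 19 w S.length := ⟨Function.update (Function.update
    (Function.update s.reg rZero (BitVec.ofNat w 0)) rOne (BitVec.ofNat w 1)) rN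
    (BitVec.ofNat w S.length), s.arr⟩ with hs₁
  have hinit : Exec S (.seq (.instr (.const rZero 0)) (.seq (.instr (.const rOne 1))
      (.instr (.len rN)))) s (1 + (1 + 1)) s₁ :=
    .seq (.instr rfl) (.seq (.instr rfl) (.instr rfl))
  let v : View := {
    i := (s₁.reg rI).toNat, t := (s₁.reg rT).toNat, j := (s₁.reg rJ).toNat
    d := (s₁.reg rD).toNat, l := (s₁.reg rL).toNat, p := (s₁.reg rP).toNat
    m := (s₁.reg rM).toNat, z := (s₁.reg rZ).toNat, c := (s₁.reg rC).toNat
    a := (s₁.reg rA).toNat, b := (s₁.reg rB).toNat, x := (s₁.reg rX).toNat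
    y := (s₁.reg rY).toNat, g := (s₁.reg rG).toNat, e := (s₁.reg rE).toNat
    h := (s₁.reg rH).toNat
    A := fun x => if h : x < S.length then (s₁.arr ⟨x, h⟩).toNat else 0, tm := 0 }
  -- the remaining registers and the array are arbitrary at the start
  have hv : v.Rep s₁ := by
    refine ⟨fun r => ?_, fun x => ?_⟩
    · by_cases h3 : 3 ≤ r
      · fin_cases r <;> first | rfl | exact absurd h3 (by decide)
      · have h0 : (s₁.reg 0).toNat = 0 := by
          simp [hs₁, rZero, rOne, rN]
        have h0' : (s₁.reg 1).toNat = 1 := by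
          simp [hs₁, rOne, rN, Nat.mod_eq_of_lt h1]
        have h0'' : (s₁.reg 2).toNat = S.length := by
          simp [hs₁, rN, Nat.mod_eq_of_lt hn]
        fin_cases r <;> first | exact h0 | exact h0' | exact h0'' | exact absurd (by decide) h3
    · change _ = dite _ _ _
      rw [dif_pos x.2]
  have hwp : (block [mov rI rZero, mov rT rZero, scanAll, closeAll]).wp (padded S) S.length
      (fun u => (∀ x < S.length, IsNss (padded S) x (x + u.A x)) ∧ u.tm ≤ 2006 * S.length + 4)
      v := by
    simp only [block, mov, Prog.wp, Instr.wp, View.get, View.set, View.tick]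
    refine ⟨by decide, by decide, scanAll_wp hf _ rfl rfl ?_⟩
    intro u h2 h3 h4
    refine closeAll_wp hf u h2 h3 fun u' h5 h6 => ⟨h5, ?_⟩
    have h7 : v.tm = 0 := rfl
    dsimp only at h4
    omega
  obtain ⟨t, s', v', h2, h3, h4, h5, h6⟩ := Prog.wp_sound hn _ hv hwp
  have h7 : v.tm = 0 := rfl
  refine ⟨_, s', .seq hinit h2, by omega, isLyndonArray_of_isNss fun x => ?_⟩
  rw [h3.2 x]
  exact h5 x x.2

/-- On words without bits, which can only hold the length of the empty string, the program halts
because no two words are different. -/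
theorem lyndonArray_exec_zero {α : Type*} [LinearOrder α] (S : List α) (s : State 19 0 S.length) :
    ∃ s', Exec S lyndonArray s 7 s' := by
  have h : ∀ (s : State 19 0 S.length) a b, (Test.lt a b).run S s = some false := fun s a b => by
    simp [Test.run, BitVec.toNat_of_zero_length]
  have h1 : ∀ {I : Instr 19} {s s' : State 19 0 S.length} {P : Prog 19} {s'' : State 19 0 S.length}
      {t : ℕ}, I.run s = some s' → Exec S P s' t s'' → Exec S (.seq (.instr I) P) s (1 + t) s'' :=
    fun h1 h2 => .seq (.instr h1) h2
  refine ⟨_, Exec.seq (t₁ := 3) (t₂ := 4) (h1 rfl (h1 rfl (.instr rfl))) (h1 (t := 3) rfl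
    (h1 (t := 2) rfl (.seq (.whileFalse (h _ _ _)) (.whileFalse (h _ _ _)))))⟩

end WordRAM

/-- One program, with a fixed number `k` of registers, computes the Lyndon array of every string
`S` in at most `c * (S.length + 1)` steps, on words that can hold the numbers `0, …, S.length`,
whatever the registers and the output array contain at the start. -/
theorem mainTheorem2 :
    ∃ (k : ℕ) (P : WordRAM.Prog k) (c : ℕ),
      ∀ (α : Type*) [LinearOrder α] [Finite α] (S : List α) (w : ℕ), S.length < 2 ^ w →
        ∀ s : WordRAM.State k w S.length,
          ∃ (t : ℕ) (s' : WordRAM.State k w S.length),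
            WordRAM.Exec S P s t s' ∧ t ≤ c * (S.length + 1) ∧
              IsLyndonArray S (fun i => (s'.arr i).toNat) := by
  refine ⟨19, WordRAM.lyndonArray, 2006, fun α _ _ S w hn s => ?_⟩
  rcases Nat.eq_zero_or_pos w with rfl | hw
  · obtain ⟨s', h⟩ := WordRAM.lyndonArray_exec_zero S s
    exact ⟨_, s', h, by omega, fun i => absurd i.2 (by omega)⟩
  · obtain ⟨t, s', h1, h2, h3⟩ := WordRAM.lyndonArray_exec S hn (Nat.one_lt_two_pow (by omega)) s
    exact ⟨t, s', h1, by omega, h3⟩
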